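/- Let $\pi:E\to B$ be a smooth surjective submersion from an $(n+1)$-dimensional manifold onto a $1$-dimensional manifold, and let $\varpi$ be a smooth nowhere vanishing $1$-form on $B$. Let $\sigma:T^*E\to E$ be the cotangent bundle with Liouville form $\Theta_\alpha(X)=\alpha(\sigma_*X)$ and symplectic form $\Omega=-d\Theta$, let $J^{1*}E=T^*E/\Lambda_0T^*E$ be the quotient vector bundle by the covectors that vanish on $\ker\pi_*$, with projection $\mu:T^*E\to J^{1*}E$, and let $\tilde\eta$ be the pullback of $\varpi$ along $J^{1*}E\to E\to B$. A pair $(\omega,\eta)$ of a closed smooth $2$-form and a closed smooth $1$-form on an odd-dimensional manifold $M$ is cosymplectic if $\flat(v)=i(v)\omega+\eta(v)\eta$ is an isomorphism $T_xM\to T_x^*M$ for all $x$. Its Reeb field is $\mathcal R=\flat^{-1}(\eta)$; the Hamiltonian field and the evolution field of $f\in C^\infty(M)$ are $X_f=\flat^{-1}(df-\mathcal R(f)\eta)$ and $E_f=\flat^{-1}(df+(1-\mathcal R(f))\eta)$, and its Poisson bracket is $\{f,g\}=\omega(X_f,X_g)$. The Hamiltonian field $X_F$ of $F\in C^\infty(T^*E)$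 with respect to $\Omega$ is defined by $i(X_F)\Omega=dF$. A connection $\nabla$ on $\pi$ is given by a smooth vector field $\mathcal Y$ on $E$ with $\pi^*\varpi(\mathcal Y)=1$; put $Ver^\nabla(X)=X-\pi^*\varpi(X)\,\mathcal Y$, and for a vector field $X$ on $E$ put $(iX)(\alpha)=\alpha(X)$ on $T^*E$. (1) The adjoint ${}^tVer^\nabla:T^*E\to T^*E$, $\alpha\mapsto\alpha\circ Ver^\nabla$, induces a smooth section $s^\nabla:J^{1*}E\to T^*E$ of $\mu$ with $s^\nabla\circ\mu={}^tVer^\nabla$. With $\tilde\omega^\nabla=(s^\nabla)^*\Omega$, the pair $(\tilde\omega^\nabla,\tilde\eta)$ is a cosymplectic structure on $J^{1*}E$, and its Reeb field $\tilde{\mathcal R}^\nabla$ satisfies $s^\nabla_*(\tilde{\mathcal R}^\nabla)=X_{i\mathcal Y}$ along $s^\nabla(J^{1*}E)$. (2) Let $\nabla'$ be another connection, with vector field $\mathcal Y'$, and let $V=\mathcal Y'-\mathcal Y$. Then $iV$ induces a smooth function $\widetilde{iV}$ on $J^{1*}E$ with $\widetilde{iV}\circ\mu=iV$, and $\tilde\omega^{\nabla'}=\tilde\omega^\nabla+d(\widetilde{iV})\wedge\tilde\eta$.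 For every $f\in C^\infty(J^{1*}E)$ the Hamiltonian fields of $f$ with respect to $(\tilde\omega^\nabla,\tilde\eta)$ and $(\tilde\omega^{\nabla'},\tilde\eta)$ coincide, and the two structures have the same Poisson bracket on $C^\infty(J^{1*}E)$. (3) Let $h\in C^\infty(J^{1*}E)$. The map $H(\alpha)=\alpha-\big(h(\mu(\alpha))+(i\mathcal Y)(\alpha)\big)\,\pi^*\varpi$ of $T^*E$ induces a smooth section $\tilde h$ of $\mu$ with $\tilde h\circ\mu=H$. With $\Omega_h=\tilde h^*\Omega$ one has $\Omega_h=\tilde\omega^\nabla+dh\wedge\tilde\eta$; the pair $(\Omega_h,\tilde\eta)$ is a cosymplectic structure on $J^{1*}E$, and its Reeb field is $\tilde{\mathcal R}^\nabla+X_h=E_h$, where $X_h$ and $E_h$ are the Hamiltonian and the evolution field of $h$ with respect to $(\tilde\omega^\nabla,\tilde\eta)$. For every $f\in C^\infty(J^{1*}E)$ the Hamiltonian fields of $f$ with respect to $(\Omega_h,\tilde\eta)$ and $(\tilde\omega^\nabla,\tilde\eta)$ coincide, and the two structures have the same Poisson bracket on $C^\infty(J^{1*}E)$. -/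

import Mathlib

open Bundle Set Function
open scoped Manifold ContDiff Topology

set_option linter.unusedSectionVars false

noncomputable section

section Forms
variable {F H : Type*} [NormedAddCommGroup F] [NormedSpace ℝ F] [TopologicalSpace H]
  {I : ModelWithCorners ℝ F H} {M : Type*} [TopologicalSpace M] [ChartedSpace H M]
  {F' H' M' : Type*} [NormedAddCommGroup F'] [NormedSpace ℝ F'] [TopologicalSpace H']
  {I' : ModelWithCorners ℝ F' H'} [TopologicalSpace M'] [ChartedSpace H' M'] {k : ℕ}

variable (I M) in
/-- Differential `k`-forms on `M` (no regularity imposed; see `DForm.IsSmooth`). -/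
abbrev DForm (k : ℕ) : Type _ := ∀ x : M, TangentSpace I x [⋀^Fin k]→L[ℝ] ℝ

namespace DForm

variable (I) in
def pullback (f : M → M') (θ : DForm I' M' k) : DForm I M k :=
  fun x => (θ (f x)).compContinuousLinearMap (mfderiv I I' f x)

/-- The coordinate expression of a form in the chart around `x₀`: its pullback along the inverse of
the chart. -/
def chartRep (θ : DForm I M k) (x₀ : M) (y : F) : F [⋀^Fin k]→L[ℝ] ℝ :=
  (pullback 𝓘(ℝ, F) (extChartAt I x₀).symm θ y).compContinuousLinearMap
    (NormedSpace.fromTangentSpace (𝕜 := ℝ) y).symm.toContinuousLinearMap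

/-- A form is smooth if all its coordinate expressions are (used for manifolds without boundary). -/
def IsSmooth (θ : DForm I M k) : Prop :=
  ∀ x₀ : M, ContDiffOn ℝ ∞ (chartRep θ x₀) (extChartAt I x₀).target

/-- The exterior derivative, computed at `x` in the chart around `x`. -/
def d (θ : DForm I M k) : DForm I M (k + 1) := fun x =>
  (extDeriv (chartRep θ x) (extChartAt I x x)).compContinuousLinearMap
    (mvfderiv I (extChartAt I x) x)

/-- A field of covectors as a `1`-form. -/
def ofCLM (a : ∀ x : M, TangentSpace I x →L[ℝ] ℝ) : DForm I M 1 :=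
  fun x => ContinuousAlternatingMap.ofSubsingleton ℝ (TangentSpace I x) ℝ 0 (a x)

variable (I) in
/-- The differential of a function. -/
def diff (f : M → ℝ) : DForm I M 1 := ofCLM fun x => mvfderiv I f x

theorem apply_add₁ {V : Type*} [AddCommGroup V] [Module ℝ V] [TopologicalSpace V]
    (c : V [⋀^Fin 1]→L[ℝ] ℝ) (u w : V) : c ![u + w] = c ![u] + c ![w] := by
  have e : ∀ z : V, update ![0] 0 z = ![z] := fun z => by
    ext i; fin_cases i; rfl
  rw [← e (u + w), ← e u, ← e w, c.map_update_add]

theorem apply_smul₁ {V : Type*} [AddCommGroup V] [Module ℝ V] [TopologicalSpace V]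
    (c : V [⋀^Fin 1]→L[ℝ] ℝ) (r : ℝ) (u : V) : c ![r • u] = r * c ![u] := by
  have e : ∀ z : V, update ![0] 0 z = ![z] := fun z => by
    ext i; fin_cases i; rfl
  rw [← e (r • u), ← e u, c.map_update_smul, smul_eq_mul]

/-- `(a ∧ b)(u, v) = a(u) b(v) - a(v) b(u)`. -/
def wedge (a b : DForm I M 1) : DForm I M 2 := fun x =>
  { toFun := fun v => a x ![v 0] * b x ![v 1] - a x ![v 1] * b x ![v 0]
    map_update_add' := by
      intro inst v i u w
      obtain rfl : inst = instDecidableEqFin 2 := Subsingleton.elim _ _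
      fin_cases i <;> simp [apply_add₁] <;> ring
    map_update_smul' := by
      intro inst v i r u
      obtain rfl : inst = instDecidableEqFin 2 := Subsingleton.elim _ _
      fin_cases i <;> simp [apply_smul₁] <;> ring
    map_eq_zero_of_eq' := by
      intro v i j hv hij
      have : v 0 = v 1 := by fin_cases i <;> fin_cases j <;> simp_all
      simp [this]
    cont := by
      have h : ∀ i : Fin 2, Continuous fun v : Fin 2 → TangentSpace I x => ![v i] := fun i => by
        fun_prop
      exact (((a x).cont.comp (h 0)).mul ((b x).cont.comp (h 1))).sub
        (((a x).cont.comp (h 1)).mul ((b x).cont.comp (h 0))) }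

/-- The value of a `1`-form at `x` as a linear functional on `T_x M`. -/
def covec (a : DForm I M 1) (x : M) : Module.Dual ℝ (TangentSpace I x) where
  toFun v := a x ![v]
  map_add' u w := apply_add₁ (a x) u w
  map_smul' r u := apply_smul₁ (a x) r u

/-- The interior product `v ↦ i(v)θ = θ(v, ·)` of a `2`-form at `x`. -/
def interior (θ : DForm I M 2) (x : M) :
    TangentSpace I x →ₗ[ℝ] Module.Dual ℝ (TangentSpace I x) :=
  LinearMap.mk₂ ℝ (fun v w => θ x ![v, w])
    (fun u u' w => by
      have e : ∀ z : TangentSpace I x, update ![0, w] 0 z = ![z, w] := fun z => by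
        ext i; fin_cases i <;> rfl
      rw [← e (u + u'), ← e u, ← e u', (θ x).map_update_add])
    (fun r u w => by
      have e : ∀ z : TangentSpace I x, update ![0, w] 0 z = ![z, w] := fun z => by
        ext i; fin_cases i <;> rfl
      rw [← e (r • u), ← e u, (θ x).map_update_smul])
    (fun u w w' => by
      have e : ∀ z : TangentSpace I x, update ![u, 0] 1 z = ![u, z] := fun z => by
        ext i; fin_cases i <;> rfl
      rw [← e (w + w'), ← e w, ← e w', (θ x).map_update_add])
    (fun r u w => by
      have e : ∀ z : TangentSpace I x, update ![u, 0] 1 z = ![u, z] := fun z => by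
        ext i; fin_cases i <;> rfl
      rw [← e (r • w), ← e w, (θ x).map_update_smul])

end DForm

/-- `♭(v) = i(v)θ + η(v) η`. -/
def flat (θ : DForm I M 2) (η : DForm I M 1) (x : M) :
    TangentSpace I x →ₗ[ℝ] Module.Dual ℝ (TangentSpace I x) :=
  θ.interior x + (η.covec x).smulRight (η.covec x)

/-- `(θ, η)` is a cosymplectic structure on the odd-dimensional manifold `M`: both forms are smooth
and closed and `♭` is an isomorphism at every point. -/
structure IsCosymplectic (θ : DForm I M 2) (η : DForm I M 1) : Prop where
  odd_dim : Odd (Module.finrank ℝ F)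
  smooth_two : θ.IsSmooth
  smooth_one : η.IsSmooth
  closed_two : θ.d = 0
  closed_one : η.d = 0
  bijective_flat : ∀ x, Bijective (flat θ η x)

/-- The Reeb vector field `♭⁻¹(η)`. -/
def reebField (θ : DForm I M 2) (η : DForm I M 1) (x : M) : TangentSpace I x :=
  invFun (flat θ η x) (η.covec x)

/-- The Hamiltonian vector field `♭⁻¹(df - df(R) η)` of `f`, where `R` is the Reeb field. -/
def cosympHamField (θ : DForm I M 2) (η : DForm I M 1) (f : M → ℝ) (x : M) : TangentSpace I x :=
  invFun (flat θ η x) ((DForm.diff I f).covec x -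
    (DForm.diff I f).covec x (reebField θ η x) • η.covec x)

/-- The evolution vector field `♭⁻¹(df + (1 - df(R)) η)` of `f`, where `R` is the Reeb field. -/
def evolutionField (θ : DForm I M 2) (η : DForm I M 1) (f : M → ℝ) (x : M) : TangentSpace I x :=
  invFun (flat θ η x) ((DForm.diff I f).covec x +
    (1 - (DForm.diff I f).covec x (reebField θ η x)) • η.covec x)

/-- The Poisson bracket `{f, g} = θ(X_f, X_g)` of a cosymplectic structure. -/
def cosympBracket (θ : DForm I M 2) (η : DForm I M 1) (f g : M → ℝ) (x : M) : ℝ :=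
  θ x ![cosympHamField θ η f x, cosympHamField θ η g x]

/-- The Hamiltonian vector field of `f` for a symplectic form `θ`: the solution of `i(X)θ = df`. -/
def sympHamField (θ : DForm I M 2) (f : M → ℝ) (x : M) : TangentSpace I x :=
  invFun (θ.interior x) ((DForm.diff I f).covec x)

end Forms

variable {n : ℕ} {E B : Type*}
  [TopologicalSpace E] [ChartedSpace (EuclideanSpace ℝ (Fin (n + 1))) E]
  [IsManifold (𝓡 (n + 1)) ∞ E]
  [TopologicalSpace B] [ChartedSpace (EuclideanSpace ℝ (Fin 1)) B]
  [IsManifold (𝓡 1) ∞ B]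

variable (n E B) in
/-- A fibered manifold `proj : E → B` (a surjective submersion) of an `(n+1)`-dimensional manifold
over a one-dimensional manifold `B` carrying a volume form `vol`. -/
structure FiberedManifold where
  proj : E → B
  contMDiff_proj : ContMDiff (𝓡 (n + 1)) (𝓡 1) ∞ proj
  surjective_proj : Surjective proj
  submersion : ∀ x, Surjective (mfderiv (𝓡 (n + 1)) (𝓡 1) proj x)
  vol : ∀ b : B, TangentSpace (𝓡 1) b →L[ℝ] ℝ
  contMDiff_vol : ContMDiff (𝓡 1) ((𝓡 1).prod 𝓘(ℝ, EuclideanSpace ℝ (Fin 1) →L[ℝ] ℝ)) ∞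
    fun b => (TotalSpace.mk b (vol b) : TotalSpace (EuclideanSpace ℝ (Fin 1) →L[ℝ] ℝ)
      fun b : B => TangentSpace (𝓡 1) b →L[ℝ] ℝ)
  vol_ne_zero : ∀ b, vol b ≠ 0

namespace FiberedManifold

variable (𝓔 : FiberedManifold n E B)

/-- The `1`-form `π^*ϖ` on `E`. -/
def clock (x : E) : TangentSpace (𝓡 (n + 1)) x →L[ℝ] ℝ :=
  (𝓔.vol (𝓔.proj x)).comp (mfderiv (𝓡 (n + 1)) (𝓡 1) 𝓔.proj x)

/-- The `π`-semibasic covectors at `x`: those that vanish on `π`-vertical vectors. -/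
def semibasic (x : E) : Submodule ℝ (TangentSpace (𝓡 (n + 1)) x →L[ℝ] ℝ) where
  carrier := {α | ∀ v, mfderiv (𝓡 (n + 1)) (𝓡 1) 𝓔.proj x v = 0 → α v = 0}
  zero_mem' := by simp
  add_mem' := by
    intro a b ha hb v hv
    simp [ha v hv, hb v hv]
  smul_mem' := by
    intro c a ha v hv
    simp [ha v hv]

/-- The fibre at `x` of `T^*E / Λ₀T^*E`. -/
def RestrictedFiber (x : E) : Type :=
  (TangentSpace (𝓡 (n + 1)) x →L[ℝ] ℝ) ⧸ 𝓔.semibasic x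
deriving TopologicalSpace, AddCommGroup, Module ℝ

/-- The class of a covector modulo semibasic covectors. -/
def mkFiber (x : E) : (TangentSpace (𝓡 (n + 1)) x →L[ℝ] ℝ) →ₗ[ℝ] 𝓔.RestrictedFiber x :=
  (𝓔.semibasic x).mkQ

/-- The map induced on the quotient by a linear map that kills semibasic covectors. -/
def liftFiber {W : Type*} [AddCommGroup W] [Module ℝ W] {x : E}
    (f : (TangentSpace (𝓡 (n + 1)) x →L[ℝ] ℝ) →ₗ[ℝ] W) (hf : ∀ α ∈ 𝓔.semibasic x, f α = 0) :
    𝓔.RestrictedFiber x →ₗ[ℝ] W :=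
  (𝓔.semibasic x).liftQ f hf

theorem mkFiber_surjective (x : E) : Surjective (𝓔.mkFiber x) :=
  (𝓔.semibasic x).mkQ_surjective

theorem mkFiber_eq_iff {x : E} {α β : TangentSpace (𝓡 (n + 1)) x →L[ℝ] ℝ} :
    𝓔.mkFiber x α = 𝓔.mkFiber x β ↔ α - β ∈ 𝓔.semibasic x :=
  Submodule.Quotient.eq _

theorem liftFiber_mk {W : Type*} [AddCommGroup W] [Module ℝ W] {x : E}
    (f : (TangentSpace (𝓡 (n + 1)) x →L[ℝ] ℝ) →ₗ[ℝ] W) (hf : ∀ α ∈ 𝓔.semibasic x, f α = 0)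
    (α : TangentSpace (𝓡 (n + 1)) x →L[ℝ] ℝ) :
    𝓔.liftFiber f hf (𝓔.mkFiber x α) = f α :=
  rfl

theorem clock_eq_zero_iff {x : E} (v : TangentSpace (𝓡 (n + 1)) x) :
    𝓔.clock x v = 0 ↔ mfderiv (𝓡 (n + 1)) (𝓡 1) 𝓔.proj x v = 0 := by
  refine ⟨fun h => ?_, fun h => by simp [clock, h]⟩
  by_contra hw
  refine 𝓔.vol_ne_zero (𝓔.proj x) (ContinuousLinearMap.ext fun u => ?_)
  have h1 : Module.finrank ℝ (TangentSpace (𝓡 1) (𝓔.proj x)) = 1 :=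
    finrank_euclideanSpace_fin (𝕜 := ℝ) (n := 1)
  obtain ⟨c, rfl⟩ := exists_smul_eq_of_finrank_eq_one h1 hw u
  have h2 : 𝓔.vol (𝓔.proj x) (mfderiv (𝓡 (n + 1)) (𝓡 1) 𝓔.proj x v) = 0 := h
  simp [h2]

/-- The coordinate vector field `∂/∂xʲ` of the chart of `E` around `x₀`. -/
def coordVec (x₀ : E) (j : Fin (n + 1)) (x : E) : TangentSpace (𝓡 (n + 1)) x :=
  (trivializationAt (EuclideanSpace ℝ (Fin (n + 1))) (TangentSpace (𝓡 (n + 1))) x₀).symmL ℝ x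
    (EuclideanSpace.single j 1)

/-- The coordinate covector field `dxʲ` of the chart of `E` around `x₀`. -/
def coordCovec (x₀ : E) (j : Fin (n + 1)) (x : E) : TangentSpace (𝓡 (n + 1)) x →L[ℝ] ℝ :=
  (EuclideanSpace.proj j : EuclideanSpace ℝ (Fin (n + 1)) →L[ℝ] ℝ).comp
  ((trivializationAt (EuclideanSpace ℝ (Fin (n + 1)))
    (TangentSpace (𝓡 (n + 1))) x₀).continuousLinearMapAt ℝ x)

/-- The vertical vector field `∂ᵢ - (τᵢ/τₖ) ∂ₖ`, where `τ = π^*ϖ`; here `i` runs over the indices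
different from `k`. Where `τₖ ≠ 0`, these fields form a frame of the vertical bundle. -/
def vertVec (x₀ : E) (k : Fin (n + 1)) (i : Fin n) (x : E) : TangentSpace (𝓡 (n + 1)) x :=
  (𝓔.clock x (coordVec x₀ k x))⁻¹ •
    (𝓔.clock x (coordVec x₀ k x) • coordVec x₀ (k.succAbove i) x -
      𝓔.clock x (coordVec x₀ (k.succAbove i) x) • coordVec x₀ k x)

theorem mfderiv_vertVec (x₀ : E) (k : Fin (n + 1)) (i : Fin n) (x : E) :
    mfderiv (𝓡 (n + 1)) (𝓡 1) 𝓔.proj x (𝓔.vertVec x₀ k i x) = 0 := by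
  rw [← clock_eq_zero_iff]
  simp only [vertVec, map_smul, map_sub, smul_eq_mul]
  ring

/-- The part of the chart domain around `x₀` on which `π^*ϖ(∂ₖ) ≠ 0`. -/
def adaptedSet (x₀ : E) (k : Fin (n + 1)) : Set E :=
  {x ∈ (trivializationAt (EuclideanSpace ℝ (Fin (n + 1))) (TangentSpace (𝓡 (n + 1))) x₀).baseSet |
    𝓔.clock x (coordVec x₀ k x) ≠ 0}

/-- Fibre coordinates `[α] ↦ (α(Wᵢ))ᵢ` given by the vertical frame `Wᵢ` above. -/
def fiberCoord (x₀ : E) (k : Fin (n + 1)) (x : E) :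
    𝓔.RestrictedFiber x →ₗ[ℝ] EuclideanSpace ℝ (Fin n) :=
  𝓔.liftFiber
    { toFun := fun α => WithLp.toLp 2 fun i => α (𝓔.vertVec x₀ k i x)
      map_add' := fun _ _ => rfl
      map_smul' := fun _ _ => rfl }
    (fun α hα => by
      ext i
      exact hα _ (𝓔.mfderiv_vertVec x₀ k i x))

/-- Inverse of the fibre coordinates: `p ↦ [∑ᵢ pᵢ dxⁱ]`. -/
def fiberCoordSymm (x₀ : E) (k : Fin (n + 1)) (x : E) :
    EuclideanSpace ℝ (Fin n) →ₗ[ℝ] 𝓔.RestrictedFiber x where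
  toFun p := 𝓔.mkFiber x (∑ i, p i • coordCovec x₀ (k.succAbove i) x)
  map_add' p q := by simp [add_smul, Finset.sum_add_distrib]
  map_smul' c p := by simp [mul_smul, Finset.smul_sum]

theorem coordCovec_coordVec {x₀ x : E}
    (hx : x ∈ (trivializationAt (EuclideanSpace ℝ (Fin (n + 1)))
      (TangentSpace (𝓡 (n + 1))) x₀).baseSet) (i j : Fin (n + 1)) :
    coordCovec x₀ i x (coordVec x₀ j x) = if i = j then 1 else 0 := by
  simp only [coordCovec, coordVec, ContinuousLinearMap.comp_apply]
  rw [Trivialization.continuousLinearMapAt_symmL _ hx]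
  simp [PiLp.single_apply]

theorem sum_coordCovec_smul {x₀ x : E}
    (hx : x ∈ (trivializationAt (EuclideanSpace ℝ (Fin (n + 1)))
      (TangentSpace (𝓡 (n + 1))) x₀).baseSet) (v : TangentSpace (𝓡 (n + 1)) x) :
    ∑ j, coordCovec x₀ j x v • coordVec x₀ j x = v := by
  simp only [coordCovec, coordVec, ContinuousLinearMap.comp_apply]
  rw [← Trivialization.symmL_continuousLinearMapAt (R := ℝ) _ hx v]
  simp only [← map_smul, ← map_sum]
  rw [Trivialization.continuousLinearMapAt_symmL _ hx]
  congr 1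
  ext i
  simp [Pi.single_apply]

theorem fiberCoord_symm {x₀ x : E} {k : Fin (n + 1)} (hx : x ∈ 𝓔.adaptedSet x₀ k)
    (p : EuclideanSpace ℝ (Fin n)) : 𝓔.fiberCoord x₀ k x (𝓔.fiberCoordSymm x₀ k x p) = p := by
  ext i
  change (∑ i, p i • coordCovec x₀ (k.succAbove i) x) (𝓔.vertVec x₀ k i x) = p i
  have h0 := hx.2
  simp only [vertVec, map_smul, map_sub, sum_apply, smul_apply, smul_eq_mul,
    coordCovec_coordVec hx.1, Fin.succAbove_right_inj, Fin.succAbove_ne]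
  simp
  field_simp

theorem fiberCoordSymm_coord {x₀ x : E} {k : Fin (n + 1)} (hx : x ∈ 𝓔.adaptedSet x₀ k)
    (a : 𝓔.RestrictedFiber x) : 𝓔.fiberCoordSymm x₀ k x (𝓔.fiberCoord x₀ k x a) = a := by
  obtain ⟨α, rfl⟩ := 𝓔.mkFiber_surjective x a
  refine 𝓔.mkFiber_eq_iff.2 fun v hv => ?_
  change (∑ i, α (𝓔.vertVec x₀ k i x) • coordCovec x₀ (k.succAbove i) x) v - α v = 0
  have hc : 𝓔.clock x v = 0 := (𝓔.clock_eq_zero_iff v).2 hv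
  have hv' := sum_coordCovec_smul hx.1 v
  have hα : α v = ∑ j, coordCovec x₀ j x v * α (coordVec x₀ j x) := by
    conv_lhs => rw [← hv']
    simp
  have hθ : 0 = ∑ j, coordCovec x₀ j x v * 𝓔.clock x (coordVec x₀ j x) := by
    rw [← hc]
    conv_lhs => rw [← hv']
    simp
  have h0 := hx.2
  rw [Fin.sum_univ_succAbove _ k] at hα hθ
  rw [hα]
  simp only [sum_apply, smul_apply, vertVec, map_smul,
    map_sub, smul_eq_mul]
  set t := 𝓔.clock x (coordVec x₀ k x)
  have e1 : ∀ i : Fin n, t⁻¹ * (t * α (coordVec x₀ (k.succAbove i) x) -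
      𝓔.clock x (coordVec x₀ (k.succAbove i) x) * α (coordVec x₀ k x)) *
        coordCovec x₀ (k.succAbove i) x v =
      coordCovec x₀ (k.succAbove i) x v * α (coordVec x₀ (k.succAbove i) x) -
      t⁻¹ * α (coordVec x₀ k x) * (coordCovec x₀ (k.succAbove i) x v *
        𝓔.clock x (coordVec x₀ (k.succAbove i) x)) := fun i => by
    field_simp
  simp only [e1, Finset.sum_sub_distrib, ← Finset.mul_sum]
  rw [show ∑ i, coordCovec x₀ (k.succAbove i) x v * 𝓔.clock x (coordVec x₀ (k.succAbove i) x)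
    = - (coordCovec x₀ k x v * t) by linarith]
  field_simp
  ring

theorem contMDiffOn_coordVec (x₀ : E) (j : Fin (n + 1)) :
    ContMDiffOn (𝓡 (n + 1)) ((𝓡 (n + 1)).prod 𝓘(ℝ, EuclideanSpace ℝ (Fin (n + 1)))) ∞
      (fun x => TotalSpace.mk' (EuclideanSpace ℝ (Fin (n + 1))) (E := TangentSpace (𝓡 (n + 1))) x
        (coordVec x₀ j x))
      (trivializationAt (EuclideanSpace ℝ (Fin (n + 1))) (TangentSpace (𝓡 (n + 1))) x₀).baseSet := by
  rw [Trivialization.contMDiffOn_section_baseSet_iff]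
  refine contMDiffOn_const (c := EuclideanSpace.single j (1 : ℝ)) |>.congr fun x hx => ?_
  rw [← Trivialization.continuousLinearMapAt_apply_of_mem (R := ℝ) _ hx, coordVec,
    Trivialization.continuousLinearMapAt_symmL _ hx]

theorem contMDiffOn_clock_coordVec (x₀ : E) (j : Fin (n + 1)) :
    ContMDiffOn (𝓡 (n + 1)) 𝓘(ℝ, ℝ) ∞ (fun x => 𝓔.clock x (coordVec x₀ j x))
      (trivializationAt (EuclideanSpace ℝ (Fin (n + 1))) (TangentSpace (𝓡 (n + 1))) x₀).baseSet := by
  have h1 := (𝓔.contMDiff_proj.contMDiff_tangentMap (m := ∞) le_rfl).comp_contMDiffOn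
    (contMDiffOn_coordVec x₀ j)
  have h2 := 𝓔.contMDiff_vol.comp 𝓔.contMDiff_proj
  have h3 := ContMDiffOn.clm_bundle_apply (F₂ := ℝ) (E₂ := fun _ : B => ℝ)
    (b := 𝓔.proj) (ϕ := fun x => 𝓔.vol (𝓔.proj x))
    (v := fun x => mfderiv (𝓡 (n + 1)) (𝓡 1) 𝓔.proj x (coordVec x₀ j x)) h2.contMDiffOn h1
  intro x hx
  have := h3 x hx
  rw [contMDiffWithinAt_totalSpace] at this
  exact this.2

theorem isOpen_adaptedSet (x₀ : E) (k : Fin (n + 1)) : IsOpen (𝓔.adaptedSet x₀ k) :=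
  (𝓔.contMDiffOn_clock_coordVec x₀ k).continuousOn.isOpen_inter_preimage
    (Trivialization.open_baseSet _) isOpen_ne

theorem exists_mem_adaptedSet (x₀ : E) : ∃ k, x₀ ∈ 𝓔.adaptedSet x₀ k := by
  have hx := FiberBundle.mem_baseSet_trivializationAt' (F := EuclideanSpace ℝ (Fin (n + 1)))
    (E := TangentSpace (𝓡 (n + 1))) x₀
  by_contra! h
  have h0 : ∀ k, 𝓔.clock x₀ (coordVec x₀ k x₀) = 0 := fun k => by
    by_contra hk
    exact h k ⟨hx, hk⟩
  have hz : ∀ v, 𝓔.clock x₀ v = 0 := fun v => by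
    rw [← sum_coordCovec_smul hx v]
    simp [h0]
  refine 𝓔.vol_ne_zero (𝓔.proj x₀) (ContinuousLinearMap.ext fun u => ?_)
  obtain ⟨v, rfl⟩ := 𝓔.submersion x₀ u
  exact hz v

/-- The local trivialization of the quotient bundle given by the fibre coordinates. -/
def pretriv (x₀ : E) (k : Fin (n + 1)) :
    Pretrivialization (EuclideanSpace ℝ (Fin n))
      (TotalSpace.proj : TotalSpace (EuclideanSpace ℝ (Fin n)) 𝓔.RestrictedFiber → E) where
  toFun z := (z.1, 𝓔.fiberCoord x₀ k z.1 z.2)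
  invFun z := ⟨z.1, 𝓔.fiberCoordSymm x₀ k z.1 z.2⟩
  source := TotalSpace.proj ⁻¹' 𝓔.adaptedSet x₀ k
  target := 𝓔.adaptedSet x₀ k ×ˢ univ
  map_source' z hz := ⟨hz, mem_univ _⟩
  map_target' z hz := hz.1
  left_inv' z hz := by
    obtain ⟨x, a⟩ := z
    simp [𝓔.fiberCoordSymm_coord hz]
  right_inv' z hz := by
    obtain ⟨x, a⟩ := z
    simp [𝓔.fiberCoord_symm hz.1]
  open_target := (𝓔.isOpen_adaptedSet x₀ k).prod isOpen_univ
  baseSet := 𝓔.adaptedSet x₀ k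
  open_baseSet := 𝓔.isOpen_adaptedSet x₀ k
  source_eq := rfl
  target_eq := rfl
  proj_toFun _ _ := rfl

theorem contMDiffOn_vertVec (x₀ : E) (k : Fin (n + 1)) (i : Fin n) :
    ContMDiffOn (𝓡 (n + 1)) ((𝓡 (n + 1)).prod 𝓘(ℝ, EuclideanSpace ℝ (Fin (n + 1)))) ∞
      (fun x => TotalSpace.mk' (EuclideanSpace ℝ (Fin (n + 1))) (E := TangentSpace (𝓡 (n + 1))) x
        (𝓔.vertVec x₀ k i x)) (𝓔.adaptedSet x₀ k) := by
  have hs : 𝓔.adaptedSet x₀ k ⊆ (trivializationAt (EuclideanSpace ℝ (Fin (n + 1)))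
    (TangentSpace (𝓡 (n + 1))) x₀).baseSet := fun x hx => hx.1
  have hk := (𝓔.contMDiffOn_clock_coordVec x₀ k).mono hs
  have hi := (𝓔.contMDiffOn_clock_coordVec x₀ (k.succAbove i)).mono hs
  have vk := (contMDiffOn_coordVec x₀ k).mono hs
  have vi := (contMDiffOn_coordVec x₀ (k.succAbove i)).mono hs
  exact (hk.inv₀ fun x hx => hx.2).smul_section ((hk.smul_section vi).sub_section
    (hi.smul_section vk))

/-- Entries of the transition matrices between two systems of fibre coordinates. -/
def transCoeff (x₀ : E) (k : Fin (n + 1)) (x₁ : E) (l : Fin (n + 1)) (i j : Fin n) (x : E) : ℝ :=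
  coordCovec x₀ (k.succAbove i) x (𝓔.vertVec x₁ l j x)

theorem contMDiffOn_transCoeff (x₀ : E) (k : Fin (n + 1)) (x₁ : E) (l : Fin (n + 1))
    (i j : Fin n) :
    ContMDiffOn (𝓡 (n + 1)) 𝓘(ℝ, ℝ) ∞ (𝓔.transCoeff x₀ k x₁ l i j)
      (𝓔.adaptedSet x₀ k ∩ 𝓔.adaptedSet x₁ l) := by
  have h1 := (𝓔.contMDiffOn_vertVec x₁ l j).mono
    (inter_subset_right (s := 𝓔.adaptedSet x₀ k))
  rw [Trivialization.contMDiffOn_section_iff (trivializationAt (EuclideanSpace ℝ (Fin (n + 1)))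
    (TangentSpace (𝓡 (n + 1))) x₀) ((𝓔.isOpen_adaptedSet x₀ k).inter (𝓔.isOpen_adaptedSet x₁ l))
    fun x hx => hx.1.1] at h1
  have h2 := (EuclideanSpace.proj (k.succAbove i) :
    EuclideanSpace ℝ (Fin (n + 1)) →L[ℝ] ℝ).contMDiff (n := ∞) |>.comp_contMDiffOn h1
  refine h2.congr fun x hx => ?_
  simp only [transCoeff, coordCovec, ContinuousLinearMap.comp_apply, comp_apply]
  rw [Trivialization.continuousLinearMapAt_apply_of_mem (R := ℝ) _ hx.1.1]

def transMap (x₀ : E) (k : Fin (n + 1)) (x₁ : E) (l : Fin (n + 1)) (x : E) :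
    EuclideanSpace ℝ (Fin n) →L[ℝ] EuclideanSpace ℝ (Fin n) :=
  ∑ i, ∑ j, 𝓔.transCoeff x₀ k x₁ l i j x •
    (EuclideanSpace.proj i : EuclideanSpace ℝ (Fin n) →L[ℝ] ℝ).smulRight
      (EuclideanSpace.single j (1 : ℝ))

theorem contMDiffOn_transMap (x₀ : E) (k : Fin (n + 1)) (x₁ : E) (l : Fin (n + 1)) :
    ContMDiffOn (𝓡 (n + 1))
      𝓘(ℝ, EuclideanSpace ℝ (Fin n) →L[ℝ] EuclideanSpace ℝ (Fin n)) ∞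
      (𝓔.transMap x₀ k x₁ l) (𝓔.adaptedSet x₀ k ∩ 𝓔.adaptedSet x₁ l) := by
  unfold transMap
  exact contMDiffOn_finsetSum fun i _ => contMDiffOn_finsetSum fun j _ =>
    (𝓔.contMDiffOn_transCoeff x₀ k x₁ l i j).smul contMDiffOn_const

theorem transMap_apply (x₀ : E) (k : Fin (n + 1)) (x₁ : E) (l : Fin (n + 1)) (x : E)
    (p : EuclideanSpace ℝ (Fin n)) :
    𝓔.transMap x₀ k x₁ l x p = 𝓔.fiberCoord x₁ l x (𝓔.fiberCoordSymm x₀ k x p) := by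
  ext j
  change _ = (∑ i, p i • coordCovec x₀ (k.succAbove i) x) (𝓔.vertVec x₁ l j x)
  simp [transMap, transCoeff, Pi.single_apply, mul_comm]

theorem pretriv_symm_apply {x₀ x : E} {k : Fin (n + 1)} (hx : x ∈ 𝓔.adaptedSet x₀ k)
    (p : EuclideanSpace ℝ (Fin n)) :
    (𝓔.pretriv x₀ k).symm x p = 𝓔.fiberCoordSymm x₀ k x p :=
  (𝓔.pretriv x₀ k).symm_apply hx p

theorem continuous_fiberCoord (x₀ : E) (k : Fin (n + 1)) (x : E) :
    Continuous (𝓔.fiberCoord x₀ k x) := by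
  refine continuous_quot_lift _ ?_
  refine (PiLp.continuous_toLp 2 _).comp (continuous_pi fun i => ?_)
  exact continuous_eval_const (𝓔.vertVec x₀ k i x)

theorem continuous_fiberCoordSymm (x₀ : E) (k : Fin (n + 1)) (x : E) :
    Continuous (𝓔.fiberCoordSymm x₀ k x) := by
  have h : Continuous (𝓔.mkFiber x) := continuous_quot_mk
  refine h.comp (continuous_finsetSum _ fun i _ => ?_)
  exact (EuclideanSpace.proj i : EuclideanSpace ℝ (Fin n) →L[ℝ] ℝ).continuous.smul
    continuous_const

/-- The smooth vector bundle structure of `T^*E / Λ₀T^*E`. -/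
def restrictedPrebundle :
    VectorPrebundle ℝ (EuclideanSpace ℝ (Fin n)) 𝓔.RestrictedFiber where
  pretrivializationAtlas := range fun z : E × Fin (n + 1) => 𝓔.pretriv z.1 z.2
  pretrivialization_linear' := by
    rintro _ ⟨⟨x₀, k⟩, rfl⟩
    exact ⟨fun x _ => ⟨(𝓔.fiberCoord x₀ k x).map_add, (𝓔.fiberCoord x₀ k x).map_smul⟩⟩
  pretrivializationAt x := 𝓔.pretriv x (𝓔.exists_mem_adaptedSet x).choose
  mem_base_pretrivializationAt x := (𝓔.exists_mem_adaptedSet x).choose_spec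
  pretrivialization_mem_atlas x := ⟨(x, _), rfl⟩
  exists_coordChange := by
    rintro _ ⟨⟨x₀, k⟩, rfl⟩ _ ⟨⟨x₁, l⟩, rfl⟩
    refine ⟨𝓔.transMap x₀ k x₁ l, (𝓔.contMDiffOn_transMap x₀ k x₁ l).continuousOn,
      fun x hx p => ?_⟩
    rw [𝓔.transMap_apply, 𝓔.pretriv_symm_apply hx.1]
    rfl
  totalSpaceMk_isInducing x := by
    set k := (𝓔.exists_mem_adaptedSet x).choose
    have hk : x ∈ 𝓔.adaptedSet x k := (𝓔.exists_mem_adaptedSet x).choose_spec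
    let e : 𝓔.RestrictedFiber x ≃ₜ EuclideanSpace ℝ (Fin n) :=
      { toFun := 𝓔.fiberCoord x k x
        invFun := 𝓔.fiberCoordSymm x k x
        left_inv := 𝓔.fiberCoordSymm_coord hk
        right_inv := 𝓔.fiberCoord_symm hk
        continuous_toFun := 𝓔.continuous_fiberCoord x k x
        continuous_invFun := 𝓔.continuous_fiberCoordSymm x k x }
    exact (Topology.isInducing_const_prod (x := x)).2 e.isInducing

instance : TopologicalSpace (TotalSpace (EuclideanSpace ℝ (Fin n)) 𝓔.RestrictedFiber) :=
  𝓔.restrictedPrebundle.totalSpaceTopology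

instance : FiberBundle (EuclideanSpace ℝ (Fin n)) 𝓔.RestrictedFiber :=
  𝓔.restrictedPrebundle.toFiberBundle

instance : VectorBundle ℝ (EuclideanSpace ℝ (Fin n)) 𝓔.RestrictedFiber :=
  𝓔.restrictedPrebundle.toVectorBundle

instance : 𝓔.restrictedPrebundle.IsContMDiff (𝓡 (n + 1)) ∞ where
  exists_contMDiffCoordChange := by
    rintro _ ⟨⟨x₀, k⟩, rfl⟩ _ ⟨⟨x₁, l⟩, rfl⟩
    refine ⟨𝓔.transMap x₀ k x₁ l, 𝓔.contMDiffOn_transMap x₀ k x₁ l, fun x hx p => ?_⟩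
    rw [𝓔.transMap_apply, 𝓔.pretriv_symm_apply hx.1]
    rfl

instance : ContMDiffVectorBundle ∞ (EuclideanSpace ℝ (Fin n)) 𝓔.RestrictedFiber (𝓡 (n + 1)) :=
  𝓔.restrictedPrebundle.contMDiffVectorBundle (𝓡 (n + 1))

variable (n E) in
/-- The extended momentum bundle `T^*E`. -/
abbrev ExtendedMomentum : Type _ :=
  TotalSpace (EuclideanSpace ℝ (Fin (n + 1)) →L[ℝ] ℝ)
    fun x : E => TangentSpace (𝓡 (n + 1)) x →L[ℝ] ℝ

variable (n) in
/-- The model of the manifold `T^*E`. -/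
abbrev extModel := (𝓡 (n + 1)).prod 𝓘(ℝ, EuclideanSpace ℝ (Fin (n + 1)) →L[ℝ] ℝ)

/-- The restricted momentum bundle `J^{1*}E = T^*E / Λ₀T^*E`. -/
abbrev RestrictedMomentum : Type _ := TotalSpace (EuclideanSpace ℝ (Fin n)) 𝓔.RestrictedFiber

variable (n) in
/-- The model of the manifold `J^{1*}E`. -/
abbrev resModel := (𝓡 (n + 1)).prod 𝓘(ℝ, EuclideanSpace ℝ (Fin n))

/-- The canonical projection `μ : T^*E → J^{1*}E`. -/
def mu (z : ExtendedMomentum n E) : 𝓔.RestrictedMomentum := ⟨z.1, 𝓔.mkFiber z.1 z.2⟩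

variable (n E) in
/-- The Liouville `1`-form `Θ` of `T^*E`: `Θ_α(X) = α(σ_* X)`. -/
def liouville : DForm (extModel n) (ExtendedMomentum n E) 1 :=
  DForm.ofCLM fun z => z.2.comp (mfderiv (extModel n) (𝓡 (n + 1))
    (TotalSpace.proj : ExtendedMomentum n E → E) z)

variable (n E) in
/-- The canonical symplectic form `Ω = -dΘ` of `T^*E`. -/
def canonicalForm : DForm (extModel n) (ExtendedMomentum n E) 2 := -(liouville n E).d

/-- The `1`-form `η̃` on `J^{1*}E`: the pullback of the volume form of `B`. -/
def eta : DForm (resModel n) 𝓔.RestrictedMomentum 1 :=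
  DForm.pullback (resModel n) (fun a : 𝓔.RestrictedMomentum => 𝓔.proj a.1)
    (DForm.ofCLM (I := 𝓡 1) 𝓔.vol)

/-- The fibrewise linear function `iX : T^*E → ℝ`, `α ↦ α(X)`, of a vector field `X` on `E`. -/
def momentumFun (X : ∀ x : E, TangentSpace (𝓡 (n + 1)) x) (z : ExtendedMomentum n E) : ℝ :=
  z.2 (X z.1)

/-- The function on `J^{1*}E` induced by `iV`, for a vertical vector field `V` on `E`. -/
def inducedFun (V : ∀ x : E, TangentSpace (𝓡 (n + 1)) x)
    (hV : ∀ x, mfderiv (𝓡 (n + 1)) (𝓡 1) 𝓔.proj x (V x) = 0) (a : 𝓔.RestrictedMomentum) : ℝ :=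
  𝓔.liftFiber
    { toFun := fun α : TangentSpace (𝓡 (n + 1)) a.1 →L[ℝ] ℝ => α (V a.1)
      map_add' := fun _ _ => rfl
      map_smul' := fun _ _ => rfl }
    (fun _ hα => hα _ (hV a.1)) a.2

/-- A connection `π^*ϖ ⊗ Y` on `π : E → B`, given by the smooth vector field `Y` that spans its
horizontal subbundle and satisfies `π^*ϖ(Y) = 1`. -/
structure Connection where
  Y : ∀ x : E, TangentSpace (𝓡 (n + 1)) x
  contMDiff_Y : ContMDiff (𝓡 (n + 1)) (𝓡 (n + 1)).tangent ∞
    fun x => (⟨x, Y x⟩ : TangentBundle (𝓡 (n + 1)) E)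
  clock_Y : ∀ x, 𝓔.clock x (Y x) = 1

namespace Connection

variable {𝓔} (Γ Γ' : 𝓔.Connection)

/-- The horizontal projector. -/
def hor (x : E) : TangentSpace (𝓡 (n + 1)) x →L[ℝ] TangentSpace (𝓡 (n + 1)) x :=
  (𝓔.clock x).smulRight (Γ.Y x)

/-- The vertical projector. -/
def ver (x : E) : TangentSpace (𝓡 (n + 1)) x →L[ℝ] TangentSpace (𝓡 (n + 1)) x :=
  ContinuousLinearMap.id ℝ _ - Γ.hor x

theorem mfderiv_ver (x : E) (v : TangentSpace (𝓡 (n + 1)) x) :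
    mfderiv (𝓡 (n + 1)) (𝓡 1) 𝓔.proj x (Γ.ver x v) = 0 := by
  rw [← clock_eq_zero_iff]
  simp [ver, hor, Γ.clock_Y]

theorem mfderiv_sub_Y (x : E) :
    mfderiv (𝓡 (n + 1)) (𝓡 1) 𝓔.proj x (Γ'.Y x - Γ.Y x) = 0 := by
  rw [← clock_eq_zero_iff]
  simp [Γ.clock_Y, Γ'.clock_Y]

/-- The adjoint `ᵗVer : T^*E → T^*E` of the vertical projector. -/
def verAdj (z : ExtendedMomentum n E) : ExtendedMomentum n E := ⟨z.1, z.2.comp (Γ.ver z.1)⟩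

/-- The linear map induced by `α ↦ α ∘ Ver` on the fibre of `J^{1*}E` at `x`. -/
def verFiber (x : E) : 𝓔.RestrictedFiber x →ₗ[ℝ] (TangentSpace (𝓡 (n + 1)) x →L[ℝ] ℝ) :=
  𝓔.liftFiber
    { toFun := fun α : TangentSpace (𝓡 (n + 1)) x →L[ℝ] ℝ => α.comp (Γ.ver x)
      map_add' := fun _ _ => rfl
      map_smul' := fun _ _ => rfl }
    (fun _ hα => ContinuousLinearMap.ext fun v => hα _ (Γ.mfderiv_ver x v))

/-- The map `J^{1*}E → T^*E` induced by `ᵗVer`. -/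
def verSection (a : 𝓔.RestrictedMomentum) : ExtendedMomentum n E := ⟨a.1, Γ.verFiber a.1 a.2⟩

/-- The `2`-form `ω̃` on `J^{1*}E`: the pullback of `Ω` along the section induced by `ᵗVer`. -/
def omega : DForm (resModel n) 𝓔.RestrictedMomentum 2 :=
  DForm.pullback (resModel n) Γ.verSection (canonicalForm n E)

/-- The function on `J^{1*}E` induced by the vertical vector field `V = Y' - Y`. -/
def diffFun : 𝓔.RestrictedMomentum → ℝ :=
  𝓔.inducedFun (fun x => Γ'.Y x - Γ.Y x) (Γ.mfderiv_sub_Y Γ')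

/-- The map `H : T^*E → T^*E`, `H(α) = α - (h(μ(α)) + α(Y)) π^*ϖ`, of a function `h` on
`J^{1*}E`. -/
def hamMap (h : 𝓔.RestrictedMomentum → ℝ) (z : ExtendedMomentum n E) : ExtendedMomentum n E :=
  ⟨z.1, z.2 - (h (𝓔.mu z) + momentumFun Γ.Y z) • 𝓔.clock z.1⟩

/-- The map `J^{1*}E → T^*E` induced by `H`; it does not depend on the representative of `a`
because `H(α) = ᵗVer(α) - h(μ(α)) π^*ϖ`. -/
def hamSection (h : 𝓔.RestrictedMomentum → ℝ) (a : 𝓔.RestrictedMomentum) :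
    ExtendedMomentum n E :=
  ⟨a.1, Γ.verFiber a.1 a.2 - h a • 𝓔.clock a.1⟩

/-- The `2`-form `Ω_h` on `J^{1*}E`: the pullback of `Ω` along the section induced by `H`. -/
def omegaHam (h : 𝓔.RestrictedMomentum → ℝ) : DForm (resModel n) 𝓔.RestrictedMomentum 2 :=
  DForm.pullback (resModel n) (Γ.hamSection h) (canonicalForm n E)

end Connection

end FiberedManifold

end

open FiberedManifold

/-! ### Smooth dependence of pulled-back alternating maps -/

section AlternatingSmooth

variable {V W G : Type*} [NormedAddCommGroup V] [NormedSpace ℝ V]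
  [NormedAddCommGroup W] [NormedSpace ℝ W] [NormedAddCommGroup G] [NormedSpace ℝ G] {k : ℕ}

/-! The argument rests on a formula for the pulled-back forms, on pointwise linear algebra, and on
the identification of one Reeb vector.

Formula. The Liouville form is tautological: its pullback along a section s of μ sends v to
s(a)(pr_* v), where pr : J^{1*}E → E. The sections `hamSection h` and `verSection` differ by h π^*ϖ,
so the pullbacks of Θ differ by h η̃. Apply -d. Since η̃ comes from a 1-form on a curve, dη̃ = 0,
and Ω_h = ω̃ + dh ∧ η̃ remains (`omegaHam_eq`). Replacing Y by Y' is the special case where h is the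
function induced by Y' - Y (`hamSection_diffFun`), so part (2) follows from part (3).

Linear algebra. If (θ, η) has Reeb vector R and ♭ is injective, then θ + dh ∧ η has Reeb vector R +
X_h, and the fields X_f and the bracket do not change (`IsReebVector.add_wedge`,
`cosympHamField_add_wedge`, `cosympBracket_add_wedge`). The inputs are η(X_f) = 0 and dh(X_f) =
θ(X_h, X_f), hence X_h(h) = 0 and X_f(h) = -X_h(f).

Reeb vector of ω̃ (`exists_isReebVector`). As Ver(Y) = 0, the function iY vanishes on the image of s
= `verSection`. The field X_{iY} projects to Y ≠ 0, so d(iY) ≠ 0, and by dimension the tangent space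
of the image is ker d(iY). It contains X_{iY}, which is therefore s_*R for some R. Then i(R)ω̃ =
s^*d(iY) = 0 and η̃(R) = π^*ϖ(Y) = 1. Nondegeneracy of Ω makes ♭ injective.

Since `DForm.d` is computed at each point in the chart around that point, naturality and
independence of the chart come first; the bundle charts of T^*E then give Θ = p dq. -/

theorem ContinuousMultilinearMap.norm_alternatization_le
    (f : ContinuousMultilinearMap ℝ (fun _ : Fin k => V) G) :
    ‖ContinuousMultilinearMap.alternatization f‖ ≤ (k.factorial : ℝ) * ‖f‖ := by
  refine ContinuousAlternatingMap.opNorm_le_bound _ (by positivity) fun v => ?_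
  rw [ContinuousMultilinearMap.alternatization_apply_apply]
  refine (norm_sum_le _ _).trans ?_
  have h : ∀ σ ∈ (Finset.univ : Finset (Equiv.Perm (Fin k))),
      ‖Equiv.Perm.sign σ • f (v ∘ σ)‖ ≤ ‖f‖ * ∏ i, ‖v i‖ := fun σ _ => by
    have h1 : ‖Equiv.Perm.sign σ • f (v ∘ σ)‖ = ‖f (v ∘ σ)‖ := by
      rcases Int.units_eq_one_or (Equiv.Perm.sign σ) with h | h <;> simp [h, Units.smul_def]
    rw [h1]
    refine (f.le_opNorm _).trans_eq ?_
    congr 1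
    exact Equiv.prod_comp σ fun i => ‖v i‖
  refine (Finset.sum_le_card_nsmul _ _ _ h).trans_eq ?_
  rw [Finset.card_univ, Fintype.card_perm, Fintype.card_fin, nsmul_eq_mul, mul_assoc]

variable (V G k) in
/-- Alternatization as a continuous linear map. -/
noncomputable def alternatizationCLM :
    ContinuousMultilinearMap ℝ (fun _ : Fin k => V) G →L[ℝ] V [⋀^Fin k]→L[ℝ] G :=
  LinearMap.mkContinuous
    { toFun := fun f => ContinuousMultilinearMap.alternatization f
      map_add' := fun f g => map_add _ f g
      map_smul' := fun c f => by
        ext v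
        simp only [ContinuousMultilinearMap.alternatization_apply_apply,
          smul_apply, RingHom.id_apply, ContinuousAlternatingMap.smul_apply, Finset.smul_sum]
        exact Finset.sum_congr rfl fun σ _ => smul_comm _ _ _ }
    (k.factorial : ℝ) fun f => f.norm_alternatization_le

/-- Each permutation contributes f itself, because its sign occurs twice. Division by k! thus
recovers an alternating map from its multilinear one by a continuous linear map, which carries
smoothness over from the multilinear setting. -/
theorem alternatizationCLM_toContinuousMultilinearMap (f : V [⋀^Fin k]→L[ℝ] G) :
    alternatizationCLM V G k f.toContinuousMultilinearMap = (k.factorial : ℝ) • f := by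
  ext v
  change ContinuousMultilinearMap.alternatization f.toContinuousMultilinearMap v = _
  rw [ContinuousMultilinearMap.alternatization_apply_apply]
  have h : ∀ σ : Equiv.Perm (Fin k),
      Equiv.Perm.sign σ • f.toContinuousMultilinearMap (v ∘ σ) = f v := fun σ => by
    have := f.toAlternatingMap.map_perm v σ
    change Equiv.Perm.sign σ • f.toAlternatingMap (v ∘ σ) = f v
    rw [this, smul_smul, Int.units_mul_self, one_smul]
    rfl
  rw [Finset.sum_congr rfl fun σ _ => h σ]
  simp [Fintype.card_perm, Nat.cast_smul_eq_nsmul]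

/-- The pullback of an alternating map by a linear map depends smoothly on both. -/
theorem ContDiffWithinAt.alternating_compContinuousLinearMap {U : Type*} [NormedAddCommGroup U]
    [NormedSpace ℝ U] {r : WithTop ℕ∞} {A : U → W [⋀^Fin k]→L[ℝ] G} {T : U → V →L[ℝ] W} {s : Set U}
    {x : U} (hA : ContDiffWithinAt ℝ r A s x) (hT : ContDiffWithinAt ℝ r T s x) :
    ContDiffWithinAt ℝ r (fun y => (A y).compContinuousLinearMap (T y)) s x := by
  have h1 : ContDiffWithinAt ℝ r (fun y => (A y).toContinuousMultilinearMap) s x :=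
    ContDiff.comp_contDiffWithinAt (g := ContinuousAlternatingMap.toContinuousMultilinearMapCLM ℝ)
      (ContinuousLinearMap.contDiff _) hA
  -- Precomposition is continuous multilinear in the k linear maps, here all equal to `T y`, hence
  -- smooth in them.
  have h2 : ContDiffWithinAt ℝ r (fun y =>
      ContinuousMultilinearMap.compContinuousLinearMapContinuousMultilinear ℝ
        (fun _ : Fin k => V) (fun _ => W) G fun _ => T y) s x :=
    (ContinuousMultilinearMap.contDiff _).comp_contDiffWithinAt (contDiffWithinAt_pi.2 fun _ => hT)
  have h3 := ((alternatizationCLM V G k).contDiff.comp_contDiffWithinAt (h2.clm_apply h1)).const_smul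
    ((k.factorial : ℝ)⁻¹)
  refine h3.congr (fun y _ => ?_) ?_ <;>
  · refine ((inv_smul_eq_iff₀ (Nat.cast_ne_zero.2 k.factorial_ne_zero)).2 ?_).symm
    rw [← alternatizationCLM_toContinuousMultilinearMap]
    rfl

end AlternatingSmooth

/-! ### Pullback and exterior derivative of forms in charts -/

section Forms
variable {F H : Type*} [NormedAddCommGroup F] [NormedSpace ℝ F] [TopologicalSpace H]
  {I : ModelWithCorners ℝ F H} {M : Type*} [TopologicalSpace M] [ChartedSpace H M]
  {F' H' M' : Type*} [NormedAddCommGroup F'] [NormedSpace ℝ F'] [TopologicalSpace H']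
  {I' : ModelWithCorners ℝ F' H'} [TopologicalSpace M'] [ChartedSpace H' M']
  {F'' H'' M'' : Type*} [NormedAddCommGroup F''] [NormedSpace ℝ F''] [TopologicalSpace H'']
  {I'' : ModelWithCorners ℝ F'' H''} [TopologicalSpace M''] [ChartedSpace H'' M''] {k : ℕ}

namespace DForm

theorem pullback_apply (f : M → M') (θ : DForm I' M' k) (x : M) (v : Fin k → TangentSpace I x) :
    pullback I f θ x v = θ (f x) fun i => mfderiv I I' f x (v i) := rfl

/-- Two forms at points that are equal take the same values on equal vectors. -/
theorem apply_congr (θ : DForm I M k) {x y : M} (h : x = y) {v w : Fin k → F} (hv : v = w) :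
    θ x (fun i => (v i : TangentSpace I x)) = θ y (fun i => (w i : TangentSpace I y)) := by
  subst h; subst hv; rfl

theorem pullback_congr {f g : M → M'} {x : M} (h : f =ᶠ[𝓝 x] g) (θ : DForm I' M' k) :
    pullback I f θ x = pullback I g θ x := by
  ext v
  refine apply_congr θ h.self_of_nhds (funext fun i => ?_)
  exact congrArg (fun T : TangentSpace I x →L[ℝ] F' => T (v i)) (h.mfderiv_eq (I := I) (I' := I'))

theorem pullback_comp {f : M → M'} {g : M' → M''} {x : M} (hg : MDifferentiableAt I' I'' g (f x))
    (hf : MDifferentiableAt I I' f x) (θ : DForm I'' M'' k) :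
    pullback I (g ∘ f) θ x = pullback I f (pullback I' g θ) x := by
  ext v
  simp only [pullback_apply, mfderiv_comp x hg hf]
  rfl

theorem chartRep_apply (θ : DForm I M k) (x₀ : M) (y : F) (v : Fin k → F) :
    chartRep θ x₀ y v = θ ((extChartAt I x₀).symm y)
      fun i => mfderiv 𝓘(ℝ, F) I (extChartAt I x₀).symm y (v i) := rfl

theorem d_apply (θ : DForm I M k) (x : M) (v : Fin (k + 1) → TangentSpace I x) :
    d θ x v = extDeriv (chartRep θ x) (extChartAt I x x)
      fun i => mvfderiv I (extChartAt I x) x (v i) := rfl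

section Smooth

variable [IsManifold I ∞ M] [IsManifold I' ∞ M'] [I.Boundaryless] [I'.Boundaryless]

theorem contMDiffAt_extChartAt_symm {x₀ : M} {y : F} (hy : y ∈ (extChartAt I x₀).target) :
    ContMDiffAt 𝓘(ℝ, F) I ∞ (extChartAt I x₀).symm y :=
  (contMDiffOn_extChartAt_symm x₀).contMDiffAt ((isOpen_extChartAt_target x₀).mem_nhds hy)

theorem contMDiffAt_extChartAt_of_mem {x₀ x : M} (hx : x ∈ (extChartAt I x₀).source) :
    ContMDiffAt I 𝓘(ℝ, F) ∞ (extChartAt I x₀) x :=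
  contMDiffAt_extChartAt' (by rwa [extChartAt_source] at hx)

/-- The coordinate expression of a map between manifolds is smooth where the map is. -/
theorem contDiffAt_writtenInCharts {f : M → M'} {x₀ : M} {x₀' : M'} {y : F}
    (hy : y ∈ (extChartAt I x₀).target)
    (hf : ContMDiffAt I I' ∞ f ((extChartAt I x₀).symm y))
    (hy' : f ((extChartAt I x₀).symm y) ∈ (extChartAt I' x₀').source) :
    ContDiffAt ℝ ∞ (extChartAt I' x₀' ∘ f ∘ (extChartAt I x₀).symm) y := by
  rw [← contMDiffAt_iff_contDiffAt]
  exact (contMDiffAt_extChartAt_of_mem hy').comp y (hf.comp y (contMDiffAt_extChartAt_symm hy))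

/-- The coordinate expression of a pullback. -/
theorem chartRep_pullback {f : M → M'} {x₀ : M} {x₀' : M'} {y : F}
    (hy : y ∈ (extChartAt I x₀).target)
    (hf : ContMDiffAt I I' ∞ f ((extChartAt I x₀).symm y))
    (hy' : f ((extChartAt I x₀).symm y) ∈ (extChartAt I' x₀').source) (θ : DForm I' M' k) :
    chartRep (pullback I f θ) x₀ y =
      (chartRep θ x₀' ((extChartAt I' x₀' ∘ f ∘ (extChartAt I x₀).symm) y)).compContinuousLinearMap
        (fderiv ℝ (extChartAt I' x₀' ∘ f ∘ (extChartAt I x₀).symm) y) := by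
  set g := extChartAt I' x₀' ∘ f ∘ (extChartAt I x₀).symm with hg
  have hn : (∞ : WithTop ℕ∞) ≠ 0 := by simp
  have h1 := (contMDiffAt_extChartAt_symm hy).mdifferentiableAt hn
  have h2 := hf.mdifferentiableAt hn
  have h3 : MDifferentiableAt 𝓘(ℝ, F) 𝓘(ℝ, F') g y :=
    ((contDiffAt_writtenInCharts hy hf hy').contMDiffAt).mdifferentiableAt hn
  have hgy : g y ∈ (extChartAt I' x₀').target := (extChartAt I' x₀').map_source hy'
  have h4 := (contMDiffAt_extChartAt_symm hgy).mdifferentiableAt hn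
  have h5 : f ∘ (extChartAt I x₀).symm =ᶠ[𝓝 y] (extChartAt I' x₀').symm ∘ g := by
    have hc : ContinuousAt (f ∘ (extChartAt I x₀).symm) y :=
      (hf.comp y (contMDiffAt_extChartAt_symm hy)).continuousAt
    filter_upwards [hc.preimage_mem_nhds ((isOpen_extChartAt_source x₀').mem_nhds hy')] with z hz
    exact ((extChartAt I' x₀').left_inv hz).symm
  have key : pullback 𝓘(ℝ, F) (extChartAt I x₀).symm (pullback I f θ) y =
      pullback 𝓘(ℝ, F) g (pullback 𝓘(ℝ, F') (extChartAt I' x₀').symm θ) y := by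
    rw [← pullback_comp h2 h1, pullback_congr h5, pullback_comp h4 h3]
  ext v
  refine (congrArg (fun A => A v) key).trans ?_
  have h6 := mfderiv_eq_fderiv (𝕜 := ℝ) (f := g) (x := y)
  exact congrArg (fun T : F →L[ℝ] F' => chartRep θ x₀' (g y) fun i => T (v i)) h6

theorem IsSmooth.contDiffAt {θ : DForm I M k} (hθ : θ.IsSmooth) {x₀ : M} {y : F}
    (hy : y ∈ (extChartAt I x₀).target) : ContDiffAt ℝ ∞ (chartRep θ x₀) y :=
  (hθ x₀).contDiffAt ((isOpen_extChartAt_target x₀).mem_nhds hy)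

theorem mem_nhds_preimage_source {f : M → M'} (hf : ContMDiff I I' ∞ f) {x₀ : M} {x₀' : M'} {y : F}
    (hy : y ∈ (extChartAt I x₀).target)
    (hy' : f ((extChartAt I x₀).symm y) ∈ (extChartAt I' x₀').source) :
    ∀ᶠ z in 𝓝 y, z ∈ (extChartAt I x₀).target ∧
      f ((extChartAt I x₀).symm z) ∈ (extChartAt I' x₀').source := by
  have hc : ContinuousAt (f ∘ (extChartAt I x₀).symm) y :=
    (hf.contMDiffAt.comp y (contMDiffAt_extChartAt_symm hy)).continuousAt
  filter_upwards [hc.preimage_mem_nhds ((isOpen_extChartAt_source x₀').mem_nhds hy'),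
    (isOpen_extChartAt_target x₀).mem_nhds hy] with z hz hz' using ⟨hz', hz⟩

/-- By `chartRep_pullback` the coordinate expression is that of θ composed with the coordinate map
g, then precomposed with Dg. All three ingredients are smooth. -/
theorem IsSmooth.pullback {θ : DForm I' M' k} (hθ : θ.IsSmooth) {f : M → M'}
    (hf : ContMDiff I I' ∞ f) : (pullback I f θ).IsSmooth := by
  intro x₀ y hy
  have hy' := mem_extChartAt_source (I := I') (f ((extChartAt I x₀).symm y))
  have hg := contDiffAt_writtenInCharts hy hf.contMDiffAt hy'
  have h1 := (hθ.contDiffAt ((extChartAt I' _).map_source hy')).comp y hg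
  have h2 := hg.fderiv_right (m := ∞) le_rfl
  have h3 := (h1.contDiffWithinAt (s := univ)).alternating_compContinuousLinearMap
    h2.contDiffWithinAt
  rw [contDiffWithinAt_univ] at h3
  refine (h3.congr_of_eventuallyEq ?_).contDiffWithinAt
  filter_upwards [mem_nhds_preimage_source hf hy hy'] with z hz
  exact chartRep_pullback hz.1 hf.contMDiffAt hz.2 θ

/-- Naturality of `extDeriv` on normed spaces, applied to the coordinate expression of f. Both
charts are arbitrary: f = id gives independence of the chart, and the charts around x and f x give
`d_pullback`. -/
theorem extDeriv_chartRep_pullback {θ : DForm I' M' k} (hθ : θ.IsSmooth) {f : M → M'}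
    (hf : ContMDiff I I' ∞ f) {x₀ : M} {x₀' : M'} {y : F} (hy : y ∈ (extChartAt I x₀).target)
    (hy' : f ((extChartAt I x₀).symm y) ∈ (extChartAt I' x₀').source) :
    extDeriv (chartRep (DForm.pullback I f θ) x₀) y =
      (extDeriv (chartRep θ x₀')
        ((extChartAt I' x₀' ∘ f ∘ (extChartAt I x₀).symm) y)).compContinuousLinearMap
        (fderiv ℝ (extChartAt I' x₀' ∘ f ∘ (extChartAt I x₀).symm) y) := by
  have hg := contDiffAt_writtenInCharts hy hf.contMDiffAt hy'
  rw [← extDeriv_pullback (r := ∞) (f := extChartAt I' x₀' ∘ f ∘ (extChartAt I x₀).symm)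
    ((hθ.contDiffAt ((extChartAt I' _).map_source hy')).differentiableAt
    (by simp)) hg (by simpa using ENat.LEInfty.out)]
  refine Filter.EventuallyEq.extDeriv_eq ?_
  filter_upwards [mem_nhds_preimage_source hf hy hy'] with z hz
  exact chartRep_pullback hz.1 hf.contMDiffAt hz.2 θ

theorem pullback_id (θ : DForm I M k) : DForm.pullback I id θ = θ := by
  ext x v
  rw [pullback_apply, mfderiv_id]
  rfl

/-- The exterior derivative may be computed in any chart. -/
theorem d_eq_of_mem_source {θ : DForm I M k} (hθ : θ.IsSmooth) {x₀ x : M}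
    (hx : x ∈ (extChartAt I x₀).source) :
    d θ x = (extDeriv (chartRep θ x₀) (extChartAt I x₀ x)).compContinuousLinearMap
      (mvfderiv I (extChartAt I x₀) x) := by
  -- The coordinate expression of the identity is the transition map between the chart around x and
  -- the one around x₀.
  have h := extDeriv_chartRep_pullback hθ (f := (id : M → M)) contMDiff_id
    (mem_extChartAt_target (I := I) x) (x₀' := x₀) (by simpa using hx)
  rw [pullback_id] at h
  have h0 : (extChartAt I x₀ ∘ id ∘ (extChartAt I x).symm) (extChartAt I x x) = extChartAt I x₀ x := by
    simp
  rw [h0] at h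
  have hn : (∞ : WithTop ℕ∞) ≠ 0 := by simp
  have hy' : id ((extChartAt I x).symm (extChartAt I x x)) ∈ (extChartAt I x₀).source := by
    simpa using hx
  have hg := ((contDiffAt_writtenInCharts (f := (id : M → M)) (mem_extChartAt_target (I := I) x)
    contMDiffAt_id hy').contMDiffAt).mdifferentiableAt hn
  have hc := mfderiv_comp x (I := I) (I' := 𝓘(ℝ, F)) (I'' := 𝓘(ℝ, F)) hg
    ((contMDiffAt_extChartAt_of_mem (mem_extChartAt_source (I := I) x)).mdifferentiableAt hn)
  have he : (extChartAt I x₀ ∘ id ∘ (extChartAt I x).symm) ∘ extChartAt I x =ᶠ[𝓝 x]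
      extChartAt I x₀ := by
    filter_upwards [extChartAt_source_mem_nhds (I := I) x] with z hz
    rw [comp_apply, comp_apply, comp_apply, (extChartAt I x).left_inv hz, id]
  rw [he.mfderiv_eq, mfderiv_eq_fderiv] at hc
  ext v
  rw [d_apply, h]
  refine congrArg (extDeriv (chartRep θ x₀) (extChartAt I x₀ x)) (funext fun i => ?_)
  exact (congrArg (fun T : TangentSpace I x →L[ℝ] F => T (v i)) hc).symm

/-- The exterior derivative commutes with pullbacks. -/
theorem d_pullback {θ : DForm I' M' k} (hθ : θ.IsSmooth) {f : M → M'} (hf : ContMDiff I I' ∞ f) :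
    d (DForm.pullback I f θ) = DForm.pullback I f (d θ) := by
  funext x
  have hn : (∞ : WithTop ℕ∞) ≠ 0 := by simp
  have hy' : f ((extChartAt I x).symm (extChartAt I x x)) ∈ (extChartAt I' (f x)).source := by
    simp
  have h := extDeriv_chartRep_pullback hθ hf (mem_extChartAt_target (I := I) x) hy'
  have h0 : (extChartAt I' (f x) ∘ f ∘ (extChartAt I x).symm) (extChartAt I x x) =
    extChartAt I' (f x) (f x) := by simp
  rw [h0] at h
  have hg := ((contDiffAt_writtenInCharts (mem_extChartAt_target (I := I) x)
    hf.contMDiffAt hy').contMDiffAt).mdifferentiableAt hn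
  have hc := mfderiv_comp x (I := I) (I' := 𝓘(ℝ, F)) (I'' := 𝓘(ℝ, F')) hg
    ((contMDiffAt_extChartAt_of_mem (mem_extChartAt_source (I := I) x)).mdifferentiableAt hn)
  have he : (extChartAt I' (f x) ∘ f ∘ (extChartAt I x).symm) ∘ extChartAt I x =ᶠ[𝓝 x]
      extChartAt I' (f x) ∘ f := by
    filter_upwards [extChartAt_source_mem_nhds (I := I) x] with z hz
    rw [comp_apply, comp_apply, comp_apply, (extChartAt I x).left_inv hz, comp_apply]
  rw [he.mfderiv_eq, mfderiv_eq_fderiv, mfderiv_comp x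
    ((contMDiffAt_extChartAt_of_mem (mem_extChartAt_source (I := I') (f x))).mdifferentiableAt hn)
    (hf.mdifferentiableAt hn)] at hc
  ext v
  rw [d_apply, h, pullback_apply, d_apply]
  refine congrArg (extDeriv (chartRep θ (f x)) (extChartAt I' (f x) (f x))) (funext fun i => ?_)
  exact (congrArg (fun T : TangentSpace I x →L[ℝ] F' => T (v i)) hc).symm

/-- The coordinate expression of the exterior derivative. -/
theorem chartRep_d {θ : DForm I M k} (hθ : θ.IsSmooth) {x₀ : M} {y : F}
    (hy : y ∈ (extChartAt I x₀).target) : chartRep (d θ) x₀ y = extDeriv (chartRep θ x₀) y := by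
  have hn : (∞ : WithTop ℕ∞) ≠ 0 := by simp
  have hx := (extChartAt I x₀).map_target hy
  have h1 := (contMDiffAt_extChartAt_symm hy).mdifferentiableAt hn
  have h2 := (contMDiffAt_extChartAt_of_mem hx).mdifferentiableAt hn
  have he : extChartAt I x₀ ∘ (extChartAt I x₀).symm =ᶠ[𝓝 y] id := by
    filter_upwards [(isOpen_extChartAt_target x₀).mem_nhds hy] with z hz
    exact (extChartAt I x₀).right_inv hz
  have hc := mfderiv_comp y h2 h1
  rw [he.mfderiv_eq, mfderiv_id] at hc
  ext v
  rw [chartRep_apply, d_eq_of_mem_source hθ hx]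
  have : ∀ w w' : Fin (k + 1) → F, ∀ z z' : F, w = w' → z = z' →
    extDeriv (chartRep θ x₀) z w = extDeriv (chartRep θ x₀) z' w' := by rintro _ _ _ _ rfl rfl; rfl
  refine this _ _ _ _ (funext fun i => ?_) ((extChartAt I x₀).right_inv hy)
  exact (congrArg (fun T : F →L[ℝ] F => T (v i)) hc).symm

theorem IsSmooth.d {θ : DForm I M k} (hθ : θ.IsSmooth) : (DForm.d θ).IsSmooth := by
  intro x₀
  refine ContDiffOn.congr ?_ fun y hy => chartRep_d hθ hy
  intro y hy
  have h := (hθ.contDiffAt hy).fderiv_right (m := ∞) le_rfl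
  exact ((ContinuousAlternatingMap.alternatizeUncurryFinCLM ℝ F ℝ).contDiff.comp_contDiffAt y
    h).contDiffWithinAt

/-- By `chartRep_d`, the coordinate expression of dθ is an exterior derivative on a whole
neighbourhood of the point, so d² = 0 on the model space applies. -/
theorem d_d {θ : DForm I M k} (hθ : θ.IsSmooth) : DForm.d (DForm.d θ) = 0 := by
  ext x v
  rw [d_apply]
  have h : chartRep (DForm.d θ) x =ᶠ[𝓝 (extChartAt I x x)] extDeriv (chartRep θ x) := by
    filter_upwards [extChartAt_target_mem_nhds (I := I) x] with y hy using chartRep_d hθ hy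
  rw [h.extDeriv_eq, extDeriv_extDeriv_apply (r := ∞)
    (hθ.contDiffAt (mem_extChartAt_target x)) (by simpa using ENat.LEInfty.out)]
  rfl

end Smooth
end DForm
end Forms

/-! ### Leibniz rule and interior products -/

section FormsCalculus
variable {F H : Type*} [NormedAddCommGroup F] [NormedSpace ℝ F] [TopologicalSpace H]
  {I : ModelWithCorners ℝ F H} {M : Type*} [TopologicalSpace M] [ChartedSpace H M] {k : ℕ}

/-- The exterior derivative of a `1`-form on a normed space. -/
theorem extDeriv_one_apply {β : F → F [⋀^Fin 1]→L[ℝ] ℝ} {x : F} (h : DifferentiableAt ℝ β x)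
    (v : Fin 2 → F) :
    extDeriv β x v = fderiv ℝ (fun y => β y ![v 1]) x (v 0) -
      fderiv ℝ (fun y => β y ![v 0]) x (v 1) := by
  rw [extDeriv_apply h, Fin.sum_univ_two]
  have h0 : (0 : Fin 2).removeNth v = ![v 1] := by
    ext i; fin_cases i; rfl
  have h1 : (1 : Fin 2).removeNth v = ![v 0] := by
    ext i; fin_cases i; rfl
  rw [h0, h1]
  simp [sub_eq_add_neg]

theorem extDeriv_smul_one_apply {g : F → ℝ} {β : F → F [⋀^Fin 1]→L[ℝ] ℝ} {x : F}
    (hg : DifferentiableAt ℝ g x) (h : DifferentiableAt ℝ β x) (v : Fin 2 → F) :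
    extDeriv (fun y => g y • β y) x v = fderiv ℝ g x (v 0) * β x ![v 1] -
      fderiv ℝ g x (v 1) * β x ![v 0] + g x * extDeriv β x v := by
  have hβ : ∀ u : F, DifferentiableAt ℝ (fun y => β y ![u]) x := fun u =>
    h.continuousAlternatingMap_apply_const ![u]
  rw [extDeriv_one_apply (hg.fun_smul h), extDeriv_one_apply h]
  have e : ∀ u w : F, fderiv ℝ (fun y => (g y • β y) ![u]) x w =
      g x * fderiv ℝ (fun y => β y ![u]) x w + fderiv ℝ g x w * β x ![u] := fun u w => by
    change fderiv ℝ (fun y => g y * β y ![u]) x w = _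
    rw [fderiv_fun_mul hg (hβ u)]
    simp [mul_comm]
  rw [e, e]
  ring

/-- More vectors than the dimension are linearly dependent. It is needed for 2-forms on the
one-dimensional base. -/
theorem ContinuousAlternatingMap.eq_zero_of_finrank_lt {V : Type*} [AddCommGroup V] [Module ℝ V]
    [TopologicalSpace V] [FiniteDimensional ℝ V] (hV : Module.finrank ℝ V < k)
    (c : V [⋀^Fin k]→L[ℝ] ℝ) : c = 0 := by
  ext v
  refine c.toAlternatingMap.map_linearDependent v fun hv => ?_
  have := hv.fintype_card_le_finrank
  simp at this
  omega

namespace DForm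

theorem covec_diff (f : M → ℝ) (x : M) (v : TangentSpace I x) :
    (diff I f).covec x v = mvfderiv I f x v := rfl

theorem covec_apply (a : DForm I M 1) (x : M) (v : TangentSpace I x) : a.covec x v = a x ![v] := rfl

theorem interior_apply (θ : DForm I M 2) (x : M) (v w : TangentSpace I x) :
    θ.interior x v w = θ x ![v, w] := rfl

theorem wedge_apply (a b : DForm I M 1) (x : M) (v w : TangentSpace I x) :
    a.wedge b x ![v, w] = a.covec x v * b.covec x w - a.covec x w * b.covec x v := rfl

theorem interior_add (θ θ' : DForm I M 2) (x : M) :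
    (θ + θ').interior x = θ.interior x + θ'.interior x := rfl

theorem interior_wedge (a b : DForm I M 1) (x : M) (v : TangentSpace I x) :
    (a.wedge b).interior x v = a.covec x v • b.covec x - b.covec x v • a.covec x := by
  ext w
  rw [interior_apply, wedge_apply]
  simp
  ring

theorem interior_self (θ : DForm I M 2) (x : M) (v : TangentSpace I x) :
    θ.interior x v v = 0 :=
  (θ x).map_eq_zero_of_eq ![v, v] (i := 0) (j := 1) rfl (by simp)

theorem interior_swap (θ : DForm I M 2) (x : M) (v w : TangentSpace I x) :
    θ.interior x v w = -θ.interior x w v := by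
  have h := interior_self θ x (v + w)
  simp only [map_add, LinearMap.add_apply, interior_self] at h
  linarith

section Smooth
variable [IsManifold I ∞ M] [I.Boundaryless]

theorem IsSmooth.add {θ θ' : DForm I M k} (hθ : θ.IsSmooth) (hθ' : θ'.IsSmooth) :
    (θ + θ').IsSmooth := fun x₀ => (hθ x₀).add (hθ' x₀)

theorem IsSmooth.neg {θ : DForm I M k} (hθ : θ.IsSmooth) : (-θ).IsSmooth :=
  fun x₀ => (hθ x₀).neg

theorem d_neg (θ : DForm I M k) : d (-θ) = -d θ := by
  ext x v
  have h : chartRep (-θ) x = (-1 : ℝ) • chartRep θ x := by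
    ext y w
    simp only [Pi.smul_apply, ContinuousAlternatingMap.smul_apply, neg_smul, one_smul]
    rfl
  rw [d_apply, h, extDeriv_smul, neg_one_smul]
  rfl

theorem d_add {θ θ' : DForm I M k} (hθ : θ.IsSmooth) (hθ' : θ'.IsSmooth) :
    d (θ + θ') = d θ + d θ' := by
  ext x v
  have hx := mem_extChartAt_target (I := I) x
  have h : chartRep (θ + θ') x = chartRep θ x + chartRep θ' x := rfl
  rw [d_apply, h, extDeriv_add ((hθ.contDiffAt hx).differentiableAt (by simp))
    ((hθ'.contDiffAt hx).differentiableAt (by simp))]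
  rfl

theorem contDiffAt_comp_extChartAt_symm {h : M → ℝ} (hh : ContMDiff I 𝓘(ℝ, ℝ) ∞ h) {x₀ : M}
    {y : F} (hy : y ∈ (extChartAt I x₀).target) :
    ContDiffAt ℝ ∞ (h ∘ (extChartAt I x₀).symm) y := by
  rw [← contMDiffAt_iff_contDiffAt]
  exact hh.contMDiffAt.comp y (contMDiffAt_extChartAt_symm hy)

theorem IsSmooth.smul {h : M → ℝ} (hh : ContMDiff I 𝓘(ℝ, ℝ) ∞ h) {θ : DForm I M k}
    (hθ : θ.IsSmooth) : IsSmooth (fun x => h x • θ x : DForm I M k) := fun _ _ hy =>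
  ((contDiffAt_comp_extChartAt_symm hh hy).smul (hθ.contDiffAt hy)).contDiffWithinAt

/-- The differential of a function in the chart around a point. -/
theorem mvfderiv_eq_fderiv_comp {h : M → ℝ} {x : M} (hh : MDifferentiableAt I 𝓘(ℝ, ℝ) h x)
    (v : TangentSpace I x) :
    mvfderiv I h x v = fderiv ℝ (h ∘ (extChartAt I x).symm) (extChartAt I x x)
      (mvfderiv I (extChartAt I x) x v) := by
  have hn : (∞ : WithTop ℕ∞) ≠ 0 := by simp
  have h1 := (contMDiffAt_extChartAt_symm (mem_extChartAt_target (I := I) x)).mdifferentiableAt hn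
  have h2 := (contMDiffAt_extChartAt_of_mem (mem_extChartAt_source (I := I) x)).mdifferentiableAt hn
  have e : (extChartAt I x).symm (extChartAt I x x) = x := by simp
  have h3 : MDifferentiableAt 𝓘(ℝ, F) 𝓘(ℝ, ℝ) (h ∘ (extChartAt I x).symm) (extChartAt I x x) :=
    MDifferentiableAt.comp _ (by rwa [e]) h1
  have hc := mfderiv_comp x h3 h2
  have he : (h ∘ (extChartAt I x).symm) ∘ extChartAt I x =ᶠ[𝓝 x] h := by
    filter_upwards [extChartAt_source_mem_nhds (I := I) x] with z hz
    rw [comp_apply, comp_apply, (extChartAt I x).left_inv hz]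
  rw [he.mfderiv_eq, mfderiv_eq_fderiv] at hc
  exact congrArg (fun T : TangentSpace I x →L[ℝ] ℝ => T v) hc

/-- The Leibniz rule for the product of a function and a `1`-form. -/
theorem d_smul {h : M → ℝ} (hh : ContMDiff I 𝓘(ℝ, ℝ) ∞ h) {η : DForm I M 1} (hη : η.IsSmooth) :
    d (fun x => h x • η x : DForm I M 1) = (diff I h).wedge η + fun x => h x • d η x := by
  have hn : (∞ : WithTop ℕ∞) ≠ 0 := by simp
  ext x v
  have hx := mem_extChartAt_target (I := I) x
  have hr : chartRep (fun x => h x • η x : DForm I M 1) x =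
    fun y => (h ∘ (extChartAt I x).symm) y • chartRep η x y := rfl
  -- The derivative of the chart at x followed by that of its inverse is the identity, so the
  -- coordinate expression gives back η at x.
  have e1 : ∀ u : TangentSpace I x,
      chartRep η x (extChartAt I x x) ![mvfderiv I (extChartAt I x) x u] = η x ![u] := by
    intro u
    have h1 := (contMDiffAt_extChartAt_symm hx).mdifferentiableAt hn
    have h2 := (contMDiffAt_extChartAt_of_mem
      (mem_extChartAt_source (I := I) x)).mdifferentiableAt hn
    have hc := mfderiv_comp x h1 h2
    have he : (extChartAt I x).symm ∘ extChartAt I x =ᶠ[𝓝 x] id := by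
      filter_upwards [extChartAt_source_mem_nhds (I := I) x] with z hz
      rw [comp_apply, (extChartAt I x).left_inv hz, id]
    rw [he.mfderiv_eq, mfderiv_id] at hc
    rw [chartRep_apply]
    refine apply_congr η ((extChartAt I x).left_inv (mem_extChartAt_source x))
      (w := ![u]) (funext fun i => ?_)
    fin_cases i
    exact (congrArg (fun T : F →L[ℝ] F => T u) hc).symm
  rw [d_apply, hr, extDeriv_smul_one_apply
    ((contDiffAt_comp_extChartAt_symm hh hx).differentiableAt hn)
    ((hη.contDiffAt hx).differentiableAt hn), e1, e1,
    ← mvfderiv_eq_fderiv_comp (hh.mdifferentiableAt hn),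
    ← mvfderiv_eq_fderiv_comp (hh.mdifferentiableAt hn), ← d_apply]
  have e2 : (h ∘ (extChartAt I x).symm) (extChartAt I x x) = h x := by simp
  rw [e2]
  rfl

end Smooth
end DForm

/-! ### Pointwise linear algebra of cosymplectic pairs -/

section LinearAlgebra

variable {θ : DForm I M 2} {η : DForm I M 1} {x : M} {R : TangentSpace I x}

theorem flat_apply (v : TangentSpace I x) :
    flat θ η x v = θ.interior x v + η.covec x v • η.covec x := rfl

/-- `♭` is injective at `x` and `R` is the Reeb vector there. -/
structure IsReebVector (θ : DForm I M 2) (η : DForm I M 1) (x : M) (R : TangentSpace I x) :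
    Prop where
  injective_flat : Injective (flat θ η x)
  interior_eq_zero : θ.interior x R = 0
  covec_eq_one : η.covec x R = 1

namespace IsReebVector

theorem bijective_flat [FiniteDimensional ℝ F] (hR : IsReebVector θ η x R) :
    Bijective (flat θ η x) := by
  have : FiniteDimensional ℝ (TangentSpace I x) := inferInstanceAs (FiniteDimensional ℝ F)
  exact ⟨hR.injective_flat, (LinearMap.injective_iff_surjective_of_finrank_eq_finrank
    (Subspace.dual_finrank_eq (K := ℝ) (V := TangentSpace I x)).symm).1 hR.injective_flat⟩

/-- Reeb, Hamiltonian and evolution fields are defined through `invFun`; with ♭ injective, each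
identification of such a field is a computation of one value of ♭. -/
theorem invFun_flat_eq (hR : IsReebVector θ η x R) {v : TangentSpace I x}
    {a : Module.Dual ℝ (TangentSpace I x)} (h : flat θ η x v = a) : invFun (flat θ η x) a = v := by
  rw [← h]
  exact leftInverse_invFun hR.injective_flat v

theorem flat_reeb (hR : IsReebVector θ η x R) : flat θ η x R = η.covec x := by
  rw [flat_apply, hR.interior_eq_zero, hR.covec_eq_one, one_smul, zero_add]

theorem reebField_eq (hR : IsReebVector θ η x R) : reebField θ η x = R :=
  hR.invFun_flat_eq hR.flat_reeb

theorem interior_reeb (hR : IsReebVector θ η x R) (v : TangentSpace I x) :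
    θ.interior x v R = 0 := by
  rw [DForm.interior_swap, hR.interior_eq_zero, LinearMap.zero_apply, neg_zero]

variable [FiniteDimensional ℝ F]

theorem flat_cosympHamField (hR : IsReebVector θ η x R) (f : M → ℝ) :
    flat θ η x (cosympHamField θ η f x) =
      (DForm.diff I f).covec x - (DForm.diff I f).covec x R • η.covec x := by
  rw [cosympHamField, hR.reebField_eq]
  exact rightInverse_invFun hR.bijective_flat.2 _

/-- Evaluate ♭(X_f) = df - R(f)η on R: the left side is η(X_f), because θ(·, R) = 0, and the right
side is R(f) - R(f). -/
theorem covec_cosympHamField (hR : IsReebVector θ η x R) (f : M → ℝ) :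
    η.covec x (cosympHamField θ η f x) = 0 := by
  have h := congrArg (fun a : Module.Dual ℝ (TangentSpace I x) => a R) (hR.flat_cosympHamField f)
  simpa [flat_apply, hR.interior_reeb, hR.covec_eq_one] using h

theorem interior_cosympHamField (hR : IsReebVector θ η x R) (f : M → ℝ) :
    θ.interior x (cosympHamField θ η f x) =
      (DForm.diff I f).covec x - (DForm.diff I f).covec x R • η.covec x := by
  rw [← hR.flat_cosympHamField f, flat_apply, hR.covec_cosympHamField, zero_smul, add_zero]

theorem cosympHamField_eq (hR : IsReebVector θ η x R) {f : M → ℝ} {X : TangentSpace I x}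
    (h0 : η.covec x X = 0) (h1 : θ.interior x X =
      (DForm.diff I f).covec x - (DForm.diff I f).covec x R • η.covec x) :
    cosympHamField θ η f x = X := by
  rw [cosympHamField, hR.reebField_eq]
  exact hR.invFun_flat_eq (by rw [flat_apply, h0, h1, zero_smul, add_zero])

theorem evolutionField_eq (hR : IsReebVector θ η x R) (f : M → ℝ) :
    evolutionField θ η f x = R + cosympHamField θ η f x := by
  rw [evolutionField, hR.reebField_eq]
  refine hR.invFun_flat_eq ?_
  rw [map_add, hR.flat_reeb, hR.flat_cosympHamField]
  module

/-- The term R(f)η in i(X_f)θ is killed by X_g. Consequently X_h(h) = 0, and X_g(f) is antisymmetric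
in f and g. -/
theorem diff_cosympHamField (hR : IsReebVector θ η x R) (f g : M → ℝ) :
    (DForm.diff I f).covec x (cosympHamField θ η g x) =
      θ.interior x (cosympHamField θ η f x) (cosympHamField θ η g x) := by
  rw [hR.interior_cosympHamField f]
  simp [hR.covec_cosympHamField]

/-- Adding `dh ∧ η` to the `2`-form adds the Hamiltonian vector of `h` to the Reeb vector. -/
theorem add_wedge (hR : IsReebVector θ η x R) (h : M → ℝ) :
    IsReebVector (θ + (DForm.diff I h).wedge η) η x (R + cosympHamField θ η h x) := by
  have h1 : η.covec x (R + cosympHamField θ η h x) = 1 := by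
    rw [map_add, hR.covec_eq_one, hR.covec_cosympHamField, add_zero]
  have h2 : (θ + (DForm.diff I h).wedge η).interior x (R + cosympHamField θ η h x) = 0 := by
    have h3 := hR.diff_cosympHamField h h
    rw [DForm.interior_self] at h3
    rw [DForm.interior_add, LinearMap.add_apply, DForm.interior_wedge, h1, map_add,
      hR.interior_eq_zero, hR.interior_cosympHamField, map_add, h3]
    module
  refine ⟨?_, h2, h1⟩
  refine (injective_iff_map_eq_zero _).2 fun v hv => ?_
  -- Pair ♭(v) = 0 with the new Reeb vector, which the new 2-form annihilates: only η(v) is left.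
  have hv0 : η.covec x v = 0 := by
    have := congrArg (fun a : Module.Dual ℝ (TangentSpace I x) =>
      a (R + cosympHamField θ η h x)) hv
    simp only [flat_apply, LinearMap.add_apply, LinearMap.smul_apply, h1] at this
    rw [DForm.interior_swap, h2] at this
    simpa using this
  rw [flat_apply, hv0, zero_smul, add_zero, DForm.interior_add, LinearMap.add_apply,
    DForm.interior_wedge, hv0, zero_smul, sub_zero] at hv
  -- Pairing with the old R now leaves dh(v) = 0, so the wedge term disappears and injectivity of
  -- the old ♭ applies.
  have hv1 := congrArg (fun a : Module.Dual ℝ (TangentSpace I x) => a R) hv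
  simp only [LinearMap.add_apply, LinearMap.smul_apply, hR.interior_reeb, hR.covec_eq_one] at hv1
  have hv2 : (DForm.diff I h).covec x v = 0 := by simpa using hv1
  rw [hv2, zero_smul, add_zero] at hv
  refine (injective_iff_map_eq_zero _).1 hR.injective_flat v ?_
  rw [flat_apply, hv, hv0, zero_smul, add_zero]

/-- Since η(X_f) = 0, the wedge adds X_f(h)η to i(X_f)θ. The new Reeb vector R + X_h adds -X_h(f)η
to the required right side. These agree by antisymmetry of θ. -/
theorem cosympHamField_add_wedge (hR : IsReebVector θ η x R) (h f : M → ℝ) :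
    cosympHamField (θ + (DForm.diff I h).wedge η) η f x = cosympHamField θ η f x := by
  refine (hR.add_wedge h).cosympHamField_eq (hR.covec_cosympHamField f) ?_
  rw [DForm.interior_add, LinearMap.add_apply, DForm.interior_wedge, hR.covec_cosympHamField,
    hR.interior_cosympHamField, map_add, hR.diff_cosympHamField h f, hR.diff_cosympHamField f h,
    DForm.interior_swap θ x (cosympHamField θ η h x)]
  module

/-- The Hamiltonian vectors are unchanged and lie in ker η, where dh ∧ η vanishes. -/
theorem cosympBracket_add_wedge (hR : IsReebVector θ η x R) (h f g : M → ℝ) :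
    cosympBracket (θ + (DForm.diff I h).wedge η) η f g x = cosympBracket θ η f g x := by
  unfold cosympBracket
  rw [hR.cosympHamField_add_wedge, hR.cosympHamField_add_wedge, ← DForm.interior_apply,
    ← DForm.interior_apply, DForm.interior_add, LinearMap.add_apply, DForm.interior_wedge,
    hR.covec_cosympHamField]
  simp [hR.covec_cosympHamField]

end IsReebVector
end LinearAlgebra
end FormsCalculus

/-! ### Charts of the cotangent bundle -/

section Cotangent
variable {F H : Type*} [NormedAddCommGroup F] [NormedSpace ℝ F] [TopologicalSpace H]
  {I : ModelWithCorners ℝ F H} {M : Type*} [TopologicalSpace M] [ChartedSpace H M]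
  [IsManifold I ∞ M] [I.Boundaryless]

/-- The trivialization of the cotangent bundle given by a chart. -/
theorem cotangent_trivializationAt_apply {x₀ x : M}
    (α : TangentSpace I x →L[ℝ] ℝ) :
    trivializationAt (F →L[ℝ] ℝ) (fun x : M => TangentSpace I x →L[ℝ] ℝ) x₀ ⟨x, α⟩ =
      (x, α.comp ((trivializationAt F (TangentSpace I) x₀).symmL ℝ x)) := by
  rw [hom_trivializationAt_apply]
  refine Prod.ext rfl ?_
  ext v
  exact congrArg (fun T : ℝ →L[ℝ] ℝ => T (α ((trivializationAt F (TangentSpace I) x₀).symmL ℝ x v)))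
    (Bundle.Trivial.continuousLinearMapAt_trivialization ℝ M ℝ x)

theorem tangent_symmL_apply {x₀ x : M} (hx : x ∈ (chartAt H x₀).source) :
    (trivializationAt F (TangentSpace I) x₀).symmL ℝ x =
      mfderiv 𝓘(ℝ, F) I (extChartAt I x₀).symm (extChartAt I x₀ x) := by
  rw [TangentBundle.symmL_trivializationAt hx, I.range_eq_univ, mfderivWithin_univ]

theorem tangent_symmL_symm_apply {x₀ : M} {y : F} (hy : y ∈ (extChartAt I x₀).target) (v : F) :
    (trivializationAt F (TangentSpace I) x₀).symmL ℝ ((extChartAt I x₀).symm y) v =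
      mfderiv 𝓘(ℝ, F) I (extChartAt I x₀).symm y v := by
  rw [tangent_symmL_apply (by simpa using (extChartAt I x₀).map_target hy)]
  exact congrArg (fun z => (mfderiv 𝓘(ℝ, F) I (extChartAt I x₀).symm z v : F))
    ((extChartAt I x₀).right_inv hy)

/-- The bundle trivialization composes a covector with the derivative of the inverse chart, which is
exactly its coordinate expression as a form. This translates smoothness as a section into
`IsSmooth`. -/
theorem DForm.isSmooth_ofCLM {a : ∀ x : M, TangentSpace I x →L[ℝ] ℝ}
    (ha : ContMDiff I (I.prod 𝓘(ℝ, F →L[ℝ] ℝ)) ∞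
      fun x => (⟨x, a x⟩ : TotalSpace (F →L[ℝ] ℝ) fun x : M => TangentSpace I x →L[ℝ] ℝ)) :
    (DForm.ofCLM a).IsSmooth := by
  intro x₀
  have h1 : ContMDiffOn I 𝓘(ℝ, F →L[ℝ] ℝ) ∞
      (fun x => (trivializationAt (F →L[ℝ] ℝ) (fun x : M => TangentSpace I x →L[ℝ] ℝ) x₀
        ⟨x, a x⟩).2) (chartAt H x₀).source := by
    have h := (Trivialization.contMDiffOn_section_baseSet_iff (n := ∞) (IB := I)
      (trivializationAt (F →L[ℝ] ℝ) (fun x : M => TangentSpace I x →L[ℝ] ℝ) x₀) (s := a)).1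
      ha.contMDiffOn
    refine h.mono fun x hx => ?_
    rw [hom_trivializationAt_baseSet]
    exact ⟨by simpa using hx, by simp⟩
  have h2 := h1.comp (contMDiffOn_extChartAt_symm (I := I) (n := ∞) x₀) fun y hy => by
    simpa using (extChartAt I x₀).map_target hy
  rw [contMDiffOn_iff_contDiffOn] at h2
  have h3 := (ContinuousAlternatingMap.ofSubsingletonLIE (𝕜 := ℝ) (E := F) (F := ℝ)
    (0 : Fin 1)).contDiff.comp_contDiffOn h2
  refine h3.congr fun y hy => ?_
  ext v
  simp only [comp_apply, cotangent_trivializationAt_apply]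
  exact congrArg (a ((extChartAt I x₀).symm y)) (tangent_symmL_symm_apply hy (v 0)).symm

/-- The chart of the cotangent bundle around `z₀`, inverted. -/
theorem cotangent_extChartAt_symm_proj
    {z₀ : TotalSpace (F →L[ℝ] ℝ) fun x : M => TangentSpace I x →L[ℝ] ℝ} {y : F × (F →L[ℝ] ℝ)}
    (hy : y ∈ (extChartAt (I.prod 𝓘(ℝ, F →L[ℝ] ℝ)) z₀).target) :
    y.1 ∈ (extChartAt I z₀.1).target ∧
    ((extChartAt (I.prod 𝓘(ℝ, F →L[ℝ] ℝ)) z₀).symm y).1 = (extChartAt I z₀.1).symm y.1 := by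
  rw [FiberBundle.extChartAt] at hy ⊢
  have h1 : y.1 ∈ (extChartAt I z₀.1).target := by
    simp only [PartialEquiv.trans_target, PartialEquiv.prod_target] at hy
    exact hy.1.1
  refine ⟨h1, ?_⟩
  rw [PartialEquiv.trans_target] at hy
  exact Trivialization.proj_symm_apply (trivializationAt (F →L[ℝ] ℝ)
    (fun x : M => TangentSpace I x →L[ℝ] ℝ) z₀.1) (x := ((extChartAt I z₀.1).symm y.1, y.2)) hy.2

/-- Identifies the fibre coordinate of the bundle chart with the canonical momentum p, the covector
read through the base chart; this is the source of Θ = p dq. -/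
theorem cotangent_extChartAt_symm_snd
    {z₀ : TotalSpace (F →L[ℝ] ℝ) fun x : M => TangentSpace I x →L[ℝ] ℝ} {y : F × (F →L[ℝ] ℝ)}
    (hy : y ∈ (extChartAt (I.prod 𝓘(ℝ, F →L[ℝ] ℝ)) z₀).target) :
    y.2 = ((extChartAt (I.prod 𝓘(ℝ, F →L[ℝ] ℝ)) z₀).symm y).2.comp
      ((trivializationAt F (TangentSpace I) z₀.1).symmL ℝ
        ((extChartAt (I.prod 𝓘(ℝ, F →L[ℝ] ℝ)) z₀).symm y).1) := by
  have h := (extChartAt (I.prod 𝓘(ℝ, F →L[ℝ] ℝ)) z₀).right_inv hy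
  set z := (extChartAt (I.prod 𝓘(ℝ, F →L[ℝ] ℝ)) z₀).symm y with hz
  have h2 := congrArg Prod.snd (cotangent_trivializationAt_apply (x₀ := z₀.1) z.2)
  rw [FiberBundle.extChartAt] at h
  exact (congrArg Prod.snd h).symm.trans h2

end Cotangent

/-! ### The Liouville form and the canonical symplectic form -/

namespace FiberedManifold
variable {n : ℕ} {E B : Type*}
  [TopologicalSpace E] [ChartedSpace (EuclideanSpace ℝ (Fin (n + 1))) E]
  [IsManifold (𝓡 (n + 1)) ∞ E]

variable (n) in
/-- The model vector space of the total space `E`. -/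
abbrev ModelVec := EuclideanSpace ℝ (Fin (n + 1))

theorem contMDiff_extProj : ContMDiff (extModel n) (𝓡 (n + 1)) ∞
    (TotalSpace.proj : ExtendedMomentum n E → E) :=
  Bundle.contMDiff_proj _

/-- In bundle charts σ is the first projection, so σ_*v is the base component of v pushed through
the inverse base chart, and the covector evaluated on it is p by `cotangent_extChartAt_symm_snd`. -/
theorem chartRep_liouville {z₀ : ExtendedMomentum n E}
    {y : ModelVec n × (ModelVec n →L[ℝ] ℝ)}
    (hy : y ∈ (extChartAt (extModel n) z₀).target)
    (v : Fin 1 → ModelVec n × (ModelVec n →L[ℝ] ℝ)) :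
    (liouville n E).chartRep z₀ y v = y.2 (v 0).1 := by
  have hn : (∞ : WithTop ℕ∞) ≠ 0 := by simp
  obtain ⟨hy1, hp⟩ := cotangent_extChartAt_symm_proj hy
  have hs := cotangent_extChartAt_symm_snd hy
  have h1 := (DForm.contMDiffAt_extChartAt_symm hy).mdifferentiableAt hn
  have h2 : MDifferentiableAt (extModel n) (𝓡 (n + 1)) (TotalSpace.proj : ExtendedMomentum n E → E)
    ((extChartAt (extModel n) z₀).symm y) := contMDiff_extProj.mdifferentiableAt hn
  have hc := mfderiv_comp y h2 h1
  have he : (TotalSpace.proj : ExtendedMomentum n E → E) ∘ (extChartAt (extModel n) z₀).symm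
      =ᶠ[𝓝 y] (extChartAt (𝓡 (n + 1)) z₀.1).symm ∘ Prod.fst := by
    filter_upwards [(isOpen_extChartAt_target z₀).mem_nhds hy] with w hw
    exact (cotangent_extChartAt_symm_proj hw).2
  have hc2 := mfderiv_comp y (I := 𝓘(ℝ, ModelVec n × (ModelVec n →L[ℝ] ℝ))) (I' := 𝓘(ℝ, ModelVec n))
    (f := Prod.fst) ((DForm.contMDiffAt_extChartAt_symm hy1).mdifferentiableAt hn)
    (mdifferentiableAt_iff_differentiableAt.2 differentiableAt_fst)
  rw [he.mfderiv_eq, hc2, mfderiv_eq_fderiv, fderiv_fst] at hc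
  rw [hs]
  refine congrArg ((extChartAt (extModel n) z₀).symm y).2 ?_
  refine (congrArg (fun T : ModelVec n × (ModelVec n →L[ℝ] ℝ) →L[ℝ] ModelVec n => T (v 0))
    hc).symm.trans ((tangent_symmL_symm_apply hy1 (v 0).1).symm.trans ?_)
  exact congrArg (fun x => ((trivializationAt (ModelVec n) (TangentSpace (𝓡 (n + 1))) z₀.1).symmL ℝ
    x (v 0).1 : ModelVec n)) hp.symm

variable (n) in
/-- The linear map `(q, p) ↦ p dq`. -/
noncomputable def liouvilleModel : (ModelVec n × (ModelVec n →L[ℝ] ℝ)) →L[ℝ]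
    (ModelVec n × (ModelVec n →L[ℝ] ℝ)) [⋀^Fin 1]→L[ℝ] ℝ :=
  (ContinuousAlternatingMap.ofSubsingletonLIE (𝕜 := ℝ)
    (E := ModelVec n × (ModelVec n →L[ℝ] ℝ)) (F := ℝ)
    (0 : Fin 1)).toContinuousLinearEquiv.toContinuousLinearMap.comp
   (((ContinuousLinearMap.compL ℝ (ModelVec n × (ModelVec n →L[ℝ] ℝ)) (ModelVec n) ℝ).flip
    (ContinuousLinearMap.fst ℝ _ _)).comp (ContinuousLinearMap.snd ℝ _ _))

theorem liouvilleModel_apply (y : ModelVec n × (ModelVec n →L[ℝ] ℝ))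
    (v : Fin 1 → ModelVec n × (ModelVec n →L[ℝ] ℝ)) : liouvilleModel n y v = y.2 (v 0).1 := rfl

theorem chartRep_liouville_eq {z₀ : ExtendedMomentum n E}
    {y : ModelVec n × (ModelVec n →L[ℝ] ℝ)}
    (hy : y ∈ (extChartAt (extModel n) z₀).target) :
    (liouville n E).chartRep z₀ y = liouvilleModel n y := by
  ext v
  rw [chartRep_liouville hy, liouvilleModel_apply]

theorem isSmooth_liouville : (liouville n E).IsSmooth := fun _ =>
  (liouvilleModel n).contDiff.contDiffOn.congr fun _ hy => chartRep_liouville_eq hy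

theorem isSmooth_canonicalForm : (canonicalForm n E).IsSmooth := isSmooth_liouville.d.neg

theorem d_canonicalForm : (canonicalForm n E).d = 0 := by
  rw [canonicalForm, DForm.d_neg, DForm.d_d isSmooth_liouville, neg_zero]

/-- The derivative at `z` of the chart of `T^*E` around `z`. -/
noncomputable abbrev chartDeriv (z : ExtendedMomentum n E) :
    TangentSpace (extModel n) z →L[ℝ] ModelVec n × (ModelVec n →L[ℝ] ℝ) :=
  mvfderiv (extModel n) (extChartAt (extModel n) z) z

theorem bijective_chartDeriv (z : ExtendedMomentum n E) : Bijective (chartDeriv z) :=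
  (isInvertible_mfderiv_extChartAt (I := extModel n) (mem_extChartAt_source z)).bijective

/-- The canonical symplectic form in coordinates: `dq ∧ dp`. -/
theorem canonicalForm_apply (z : ExtendedMomentum n E) (X X' : TangentSpace (extModel n) z) :
    canonicalForm n E z ![X, X'] =
      (chartDeriv z X').2 (chartDeriv z X).1 - (chartDeriv z X).2 (chartDeriv z X').1 := by
  have he : (liouville n E).chartRep z =ᶠ[𝓝 (extChartAt (extModel n) z z)] liouvilleModel n := by
    filter_upwards [extChartAt_target_mem_nhds (I := extModel n) z] with y hy
    exact chartRep_liouville_eq hy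
  change -((liouville n E).d z ![X, X']) = _
  rw [DForm.d_apply, he.extDeriv_eq, extDeriv_one_apply (liouvilleModel n).differentiableAt]
  have h : ∀ u w y : ModelVec n × (ModelVec n →L[ℝ] ℝ),
      fderiv ℝ (fun y => liouvilleModel n y ![u]) y w = w.2 u.1 := fun u w y => by
    have : (fun y => liouvilleModel n y ![u]) =
      ((ContinuousLinearMap.apply ℝ ℝ u.1).comp (ContinuousLinearMap.snd ℝ _ _) :
        ModelVec n × (ModelVec n →L[ℝ] ℝ) →L[ℝ] ℝ) := rfl
    rw [this, ContinuousLinearMap.fderiv]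
    rfl
  rw [h, h]
  exact neg_sub _ _

theorem injective_interior_canonicalForm (z : ExtendedMomentum n E) :
    Injective ((canonicalForm n E).interior z) := by
  refine (injective_iff_map_eq_zero _).2 fun X hX => ?_
  -- Pair X with the vector of coordinates (u, w). The choice u = 0 kills the base component of X,
  -- and w = 0 kills its fibre component.
  have h : ∀ (u : ModelVec n) (w : ModelVec n →L[ℝ] ℝ),
      w (chartDeriv z X).1 - (chartDeriv z X).2 u = 0 := fun u w => by
    obtain ⟨X', hX'⟩ := (bijective_chartDeriv z).2 (u, w)
    have := congrArg (fun a : Module.Dual ℝ (TangentSpace (extModel n) z) => a X') hX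
    simpa only [DForm.interior_apply, canonicalForm_apply, hX', LinearMap.zero_apply] using this
  have h1 : (chartDeriv z X).1 = 0 := by
    by_contra h0
    obtain ⟨w, hw⟩ := SeparatingDual.exists_ne_zero (R := ℝ) h0
    exact hw (by simpa using h 0 w)
  have h2 : (chartDeriv z X).2 = 0 := by
    ext u
    simpa using h u 0
  exact (bijective_chartDeriv z).1 ((Prod.ext h1 h2).trans (map_zero (chartDeriv z)).symm)

theorem bijective_interior_canonicalForm (z : ExtendedMomentum n E) :
    Bijective ((canonicalForm n E).interior z) := by
  have : FiniteDimensional ℝ (TangentSpace (extModel n) z) :=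
    inferInstanceAs (FiniteDimensional ℝ (ModelVec n × (ModelVec n →L[ℝ] ℝ)))
  exact ⟨injective_interior_canonicalForm z,
    (LinearMap.injective_iff_surjective_of_finrank_eq_finrank
      (Subspace.dual_finrank_eq (K := ℝ) (V := TangentSpace (extModel n) z)).symm).1
      (injective_interior_canonicalForm z)⟩

theorem contMDiff_momentumFun {Y : ∀ x : E, TangentSpace (𝓡 (n + 1)) x}
    (hY : ContMDiff (𝓡 (n + 1)) (𝓡 (n + 1)).tangent ∞
      fun x => (⟨x, Y x⟩ : TangentBundle (𝓡 (n + 1)) E)) :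
    ContMDiff (extModel n) 𝓘(ℝ, ℝ) ∞ (momentumFun Y) := by
  intro z
  have h := ContMDiffAt.clm_bundle_apply (F₂ := ℝ) (E₂ := fun _ : E => ℝ)
    (b := (TotalSpace.proj : ExtendedMomentum n E → E)) (ϕ := fun z => z.2)
    (v := fun z => Y z.1) (x := z) (contMDiff_id (I := extModel n)).contMDiffAt
    (hY.comp contMDiff_extProj).contMDiffAt
  rw [contMDiffAt_totalSpace] at h
  exact h.2

/-- Shows iY as p applied to the components of Y at q: for fixed q it is linear in p, so its
derivative along the fibre can be read off. -/
theorem momentumFun_extChartAt_symm (Y : ∀ x : E, TangentSpace (𝓡 (n + 1)) x)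
    {z₀ : ExtendedMomentum n E} {y : ModelVec n × (ModelVec n →L[ℝ] ℝ)}
    (hy : y ∈ (extChartAt (extModel n) z₀).target) :
    momentumFun Y ((extChartAt (extModel n) z₀).symm y) =
      y.2 ((trivializationAt (ModelVec n) (TangentSpace (𝓡 (n + 1))) z₀.1).continuousLinearMapAt ℝ
        ((extChartAt (𝓡 (n + 1)) z₀.1).symm y.1) (Y ((extChartAt (𝓡 (n + 1)) z₀.1).symm y.1))) := by
  obtain ⟨hy1, hp⟩ := cotangent_extChartAt_symm_proj hy
  have hx : (extChartAt (𝓡 (n + 1)) z₀.1).symm y.1 ∈ (trivializationAt (ModelVec n)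
      (TangentSpace (𝓡 (n + 1))) z₀.1).baseSet := by
    simpa using (extChartAt (𝓡 (n + 1)) z₀.1).map_target hy1
  rw [← hp] at hx ⊢
  rw [cotangent_extChartAt_symm_snd hy, ContinuousLinearMap.comp_apply,
    Trivialization.symmL_continuousLinearMapAt _ hx]
  rfl

theorem chartDeriv_fst (z : ExtendedMomentum n E) (X : TangentSpace (extModel n) z) :
    mvfderiv (𝓡 (n + 1)) (extChartAt (𝓡 (n + 1)) z.1) z.1
      (mfderiv (extModel n) (𝓡 (n + 1)) (TotalSpace.proj : ExtendedMomentum n E → E) z X) =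
    (chartDeriv z X).1 := by
  have hn : (∞ : WithTop ℕ∞) ≠ 0 := by simp
  have h1 : MDifferentiableAt (extModel n) (𝓡 (n + 1)) (TotalSpace.proj : ExtendedMomentum n E → E)
    z := contMDiff_extProj.mdifferentiableAt hn
  have h2 := (DForm.contMDiffAt_extChartAt_of_mem
    (mem_extChartAt_source (I := 𝓡 (n + 1)) z.1)).mdifferentiableAt hn
  have h3 := (DForm.contMDiffAt_extChartAt_of_mem
    (mem_extChartAt_source (I := extModel n) z)).mdifferentiableAt hn
  have hc1 := mfderiv_comp z h2 h1
  have hc2 := mfderiv_comp z (I' := 𝓘(ℝ, ModelVec n × (ModelVec n →L[ℝ] ℝ)))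
    (I'' := 𝓘(ℝ, ModelVec n)) (g := Prod.fst)
    (mdifferentiableAt_iff_differentiableAt.2 differentiableAt_fst) h3
  have he : extChartAt (𝓡 (n + 1)) z.1 ∘ (TotalSpace.proj : ExtendedMomentum n E → E) =ᶠ[𝓝 z]
      Prod.fst ∘ extChartAt (extModel n) z := by
    filter_upwards [extChartAt_source_mem_nhds (I := extModel n) z] with w hw
    rw [FiberBundle.extChartAt] at hw ⊢
    rw [PartialEquiv.trans_source] at hw
    exact (congrArg (extChartAt (𝓡 (n + 1)) z.1) (Trivialization.coe_fst _ hw.1)).symm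
  rw [he.mfderiv_eq, hc2, mfderiv_eq_fderiv, fderiv_fst] at hc1
  exact (congrArg (fun T : TangentSpace (extModel n) z →L[ℝ] ModelVec n => T X) hc1).symm

/-- The Hamiltonian vector field of `iY` projects to `Y`. -/
theorem mfderiv_proj_of_interior_eq {Y : ∀ x : E, TangentSpace (𝓡 (n + 1)) x}
    (hY : ContMDiff (𝓡 (n + 1)) (𝓡 (n + 1)).tangent ∞
      fun x => (⟨x, Y x⟩ : TangentBundle (𝓡 (n + 1)) E))
    {z : ExtendedMomentum n E} {X : TangentSpace (extModel n) z}
    (hX : (canonicalForm n E).interior z X =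
      (DForm.diff (extModel n) (momentumFun Y)).covec z) :
    mfderiv (extModel n) (𝓡 (n + 1)) (TotalSpace.proj : ExtendedMomentum n E → E) z X = Y z.1 := by
  have hn : (∞ : WithTop ℕ∞) ≠ 0 := by simp
  have hz := mem_extChartAt_target (I := extModel n) z
  set ψ := extChartAt (extModel n) z with hψ
  set c : ModelVec n := mvfderiv (𝓡 (n + 1)) (extChartAt (𝓡 (n + 1)) z.1) z.1 (Y z.1) with hcdef
  have hinj : Injective (mvfderiv (𝓡 (n + 1)) (extChartAt (𝓡 (n + 1)) z.1) z.1) :=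
    (isInvertible_mfderiv_extChartAt (I := 𝓡 (n + 1)) (mem_extChartAt_source z.1)).bijective.1
  refine hinj ?_
  rw [chartDeriv_fst]
  refine sub_eq_zero.1 ?_
  by_contra h0
  obtain ⟨p, hp⟩ := SeparatingDual.exists_ne_zero (R := ℝ) h0
  refine hp ?_
  -- Test with a vertical vector: Ω(X, X') is p of the base component of X, while d(iY)(X') should
  -- be p(c), with c the components of Y.
  obtain ⟨X', hX'⟩ := (bijective_chartDeriv z).2 (0, p)
  have h1 := congrArg (fun a : Module.Dual ℝ (TangentSpace (extModel n) z) => a X') hX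
  simp only [DForm.interior_apply, canonicalForm_apply, hX', DForm.covec_diff, map_zero,
    sub_zero] at h1
  rw [DForm.mvfderiv_eq_fderiv_comp ((contMDiff_momentumFun hY).mdifferentiableAt hn)] at h1
  rw [map_sub, h1, sub_eq_zero]
  have hd : HasFDerivAt (momentumFun Y ∘ ψ.symm) _ (ψ z) :=
    ((DForm.contDiffAt_comp_extChartAt_symm (contMDiff_momentumFun hY) hz).differentiableAt
      hn).hasFDerivAt
  have hl : HasDerivAt (fun t : ℝ => ψ z + t • ((0, p) : ModelVec n × (ModelVec n →L[ℝ] ℝ)))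
      (0, p) 0 := by
    simpa using ((hasDerivAt_id (0 : ℝ)).smul_const
      ((0, p) : ModelVec n × (ModelVec n →L[ℝ] ℝ))).const_add (ψ z)
  have hd1 := HasFDerivAt.comp_hasDerivAt (0 : ℝ) (by rw [zero_smul, add_zero]; exact hd) hl
  have hd2 : HasDerivAt (fun t : ℝ => (ψ z).2 c + t * p c) (p c) 0 := by
    simpa using ((hasDerivAt_id (0 : ℝ)).mul_const (p c)).const_add ((ψ z).2 c)
  have hx1 : (extChartAt (𝓡 (n + 1)) z.1).symm (ψ z).1 = z.1 := by
    rw [← (cotangent_extChartAt_symm_proj hz).2, (extChartAt (extModel n) z).left_inv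
      (mem_extChartAt_source z)]
  -- Along this vertical line the base point is fixed, so iY is affine in t with slope p c;
  -- uniqueness of derivatives concludes.
  have he : (momentumFun Y ∘ ψ.symm) ∘
      (fun t : ℝ => ψ z + t • ((0, p) : ModelVec n × (ModelVec n →L[ℝ] ℝ))) =ᶠ[𝓝 0]
      fun t : ℝ => (ψ z).2 c + t * p c := by
    have hcont : ContinuousAt
      (fun t : ℝ => ψ z + t • ((0, p) : ModelVec n × (ModelVec n →L[ℝ] ℝ))) 0 := hl.continuousAt
    have hm : ψ.target ∈ 𝓝 (ψ z + (0 : ℝ) • ((0, p) : ModelVec n × (ModelVec n →L[ℝ] ℝ))) := by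
      rw [zero_smul, add_zero]
      exact extChartAt_target_mem_nhds (I := extModel n) z
    filter_upwards [hcont.preimage_mem_nhds hm] with t ht
    rw [comp_apply, comp_apply, momentumFun_extChartAt_symm Y ht]
    have h2 : (ψ z + t • ((0, p) : ModelVec n × (ModelVec n →L[ℝ] ℝ))).1 = (ψ z).1 := by simp
    rw [h2, hx1, TangentBundle.continuousLinearMapAt_trivializationAt (mem_chart_source _ z.1)]
    rfl
  have hX2 : mvfderiv (extModel n) ψ z X' = (0, p) := hX'
  rw [hX2]
  exact (hd1.congr_of_eventuallyEq he.symm).unique hd2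

/-- Every `1`-form on a one-dimensional manifold is closed. -/
theorem d_eq_zero_of_one_dim {B : Type*} [TopologicalSpace B]
    [ChartedSpace (EuclideanSpace ℝ (Fin 1)) B] (θ : DForm (𝓡 1) B 1) : θ.d = 0 := by
  funext b
  have : FiniteDimensional ℝ (TangentSpace (𝓡 1) b) :=
    inferInstanceAs (FiniteDimensional ℝ (EuclideanSpace ℝ (Fin 1)))
  refine ContinuousAlternatingMap.eq_zero_of_finrank_lt ?_ _
  rw [show Module.finrank ℝ (TangentSpace (𝓡 1) b) = 1 from
    finrank_euclideanSpace_fin (𝕜 := ℝ) (n := 1)]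
  norm_num

end FiberedManifold

/-! ### Smoothness of μ and of its sections -/

namespace FiberedManifold
variable {n : ℕ} {E B : Type*}
  [TopologicalSpace E] [ChartedSpace (EuclideanSpace ℝ (Fin (n + 1))) E]
  [IsManifold (𝓡 (n + 1)) ∞ E]
  [TopologicalSpace B] [ChartedSpace (EuclideanSpace ℝ (Fin 1)) B]
  [IsManifold (𝓡 1) ∞ B]

section CovectorsAlongMaps

variable {G K N : Type*} [NormedAddCommGroup G] [NormedSpace ℝ G] [TopologicalSpace K]
  {J : ModelWithCorners ℝ G K} [TopologicalSpace N] [ChartedSpace K N]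
  {b : N → E} {A : ∀ a, TangentSpace (𝓡 (n + 1)) (b a) →L[ℝ] ℝ} {a₀ : N}

/-- A field of covectors along a map is smooth if its components are. -/
theorem contMDiffAt_covec_of_coord (hb : ContMDiffAt J (𝓡 (n + 1)) ∞ b a₀)
    (h : ∀ j, ContMDiffAt J 𝓘(ℝ, ℝ) ∞ (fun a => A a (coordVec (b a₀) j (b a))) a₀) :
    ContMDiffAt J (extModel n) ∞ (fun a => (⟨b a, A a⟩ : ExtendedMomentum n E)) a₀ := by
  rw [contMDiffAt_totalSpace]
  refine ⟨hb, ?_⟩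
  -- The trivialized covector is expanded in the dual basis, with its values on the coordinate
  -- fields as coefficients.
  have hs : ContMDiffAt J 𝓘(ℝ, ModelVec n →L[ℝ] ℝ) ∞ (fun a => ∑ j, A a (coordVec (b a₀) j (b a)) •
      (EuclideanSpace.proj j : ModelVec n →L[ℝ] ℝ)) a₀ :=
    contMDiffAt_finsetSum fun j _ => (h j).smul contMDiffAt_const
  refine hs.congr_of_eventuallyEq (Filter.Eventually.of_forall fun a => ?_)
  change (trivializationAt (ModelVec n →L[ℝ] ℝ) (fun x : E => TangentSpace (𝓡 (n + 1)) x →L[ℝ] ℝ)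
    (b a₀) ⟨b a, A a⟩).2 = _
  rw [cotangent_trivializationAt_apply]
  ext v
  have hv : v = ∑ j, v j • EuclideanSpace.single j (1 : ℝ) := by
    ext i
    simp [Pi.single_apply]
  conv_lhs => rw [hv]
  simp [coordVec, mul_comm]

/-- The evaluation of a smooth field of covectors on a smooth field of vectors is smooth. -/
theorem contMDiffAt_covec_apply {W : ∀ a, TangentSpace (𝓡 (n + 1)) (b a)}
    (hA : ContMDiffAt J (extModel n) ∞ (fun a => (⟨b a, A a⟩ : ExtendedMomentum n E)) a₀)
    (hW : ContMDiffAt J (𝓡 (n + 1)).tangent ∞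
      (fun a => (⟨b a, W a⟩ : TangentBundle (𝓡 (n + 1)) E)) a₀) :
    ContMDiffAt J 𝓘(ℝ, ℝ) ∞ (fun a => A a (W a)) a₀ := by
  have h := ContMDiffAt.clm_bundle_apply (F₂ := ℝ) (E₂ := fun _ : E => ℝ) hA hW
  rw [contMDiffAt_totalSpace] at h
  exact h.2

end CovectorsAlongMaps

theorem mem_baseSet_self (x₀ : E) :
    x₀ ∈ (trivializationAt (ModelVec n) (TangentSpace (𝓡 (n + 1))) x₀).baseSet :=
  FiberBundle.mem_baseSet_trivializationAt' x₀

theorem contMDiffAt_coordVec (x₀ : E) (j : Fin (n + 1)) :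
    ContMDiffAt (𝓡 (n + 1)) (𝓡 (n + 1)).tangent ∞
      (fun x => (⟨x, coordVec x₀ j x⟩ : TangentBundle (𝓡 (n + 1)) E)) x₀ :=
  (contMDiffOn_coordVec x₀ j).contMDiffAt
    ((Trivialization.open_baseSet _).mem_nhds (mem_baseSet_self x₀))

theorem contMDiffAt_coordCovec_apply {x₀ : E} {W : ∀ x : E, TangentSpace (𝓡 (n + 1)) x}
    (hW : ContMDiffAt (𝓡 (n + 1)) (𝓡 (n + 1)).tangent ∞
      (fun x => (⟨x, W x⟩ : TangentBundle (𝓡 (n + 1)) E)) x₀) (i : Fin (n + 1)) :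
    ContMDiffAt (𝓡 (n + 1)) 𝓘(ℝ, ℝ) ∞ (fun x => coordCovec x₀ i x (W x)) x₀ := by
  rw [contMDiffAt_totalSpace] at hW
  have h := (EuclideanSpace.proj i : ModelVec n →L[ℝ] ℝ).contMDiff (n := ∞) |>.contMDiffAt.comp x₀
    hW.2
  refine h.congr_of_eventuallyEq ?_
  filter_upwards [(Trivialization.open_baseSet _).mem_nhds (mem_baseSet_self (n := n) x₀)] with x hx
  simp only [coordCovec, ContinuousLinearMap.comp_apply, comp_apply]
  rw [Trivialization.continuousLinearMapAt_apply_of_mem (R := ℝ) _ hx]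

variable (𝓔 : FiberedManifold n E B)

theorem contMDiffAt_clock_coordVec (x₀ : E) (j : Fin (n + 1)) :
    ContMDiffAt (𝓡 (n + 1)) 𝓘(ℝ, ℝ) ∞ (fun x => 𝓔.clock x (coordVec x₀ j x)) x₀ :=
  (𝓔.contMDiffOn_clock_coordVec x₀ j).contMDiffAt
    ((Trivialization.open_baseSet _).mem_nhds (mem_baseSet_self x₀))

theorem contMDiff_resProj : ContMDiff (resModel n) (𝓡 (n + 1)) ∞
    (TotalSpace.proj : 𝓔.RestrictedMomentum → E) :=
  Bundle.contMDiff_proj _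

/-- The index of the fibre coordinates used by the bundle trivialization around `x₀`. -/
noncomputable def adaptedIndex (x₀ : E) : Fin (n + 1) := (𝓔.exists_mem_adaptedSet x₀).choose

theorem mem_adaptedSet_adaptedIndex (x₀ : E) : x₀ ∈ 𝓔.adaptedSet x₀ (𝓔.adaptedIndex x₀) :=
  (𝓔.exists_mem_adaptedSet x₀).choose_spec

/-- In fibre coordinates μ sends α to its values on the smooth vertical frame `vertVec`. -/
theorem contMDiff_mu : ContMDiff (extModel n) (resModel n) ∞ 𝓔.mu := by
  intro z₀
  rw [contMDiffAt_totalSpace]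
  refine ⟨contMDiff_extProj.contMDiffAt, ?_⟩
  have hi : ∀ i, ContMDiffAt (extModel n) 𝓘(ℝ, ℝ) ∞ (fun z : ExtendedMomentum n E =>
      z.2 (𝓔.vertVec z₀.1 (𝓔.adaptedIndex z₀.1) i z.1)) z₀ := fun i =>
    contMDiffAt_covec_apply (A := fun z : ExtendedMomentum n E => z.2)
      (contMDiff_id (I := extModel n)).contMDiffAt
      (((𝓔.contMDiffOn_vertVec z₀.1 (𝓔.adaptedIndex z₀.1) i).contMDiffAt
        ((𝓔.isOpen_adaptedSet _ _).mem_nhds (𝓔.mem_adaptedSet_adaptedIndex z₀.1))).comp z₀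
        contMDiff_extProj.contMDiffAt)
  exact ((PiLp.continuousLinearEquiv 2 ℝ fun _ : Fin n => ℝ).symm :
    (Fin n → ℝ) →L[ℝ] EuclideanSpace ℝ (Fin n)).contMDiff.contMDiffAt.comp z₀
    (contMDiffAt_pi_space.2 hi)

namespace Connection
variable {𝓔} (Γ Γ' : 𝓔.Connection)

/-- Near a₀ a class has the representative ∑ pᵢ dxⁱ, with p its fibre coordinates. The components of
the section are then ∑ pᵢ dxⁱ(Ver ∂ⱼ). -/
theorem contMDiff_verSection : ContMDiff (resModel n) (extModel n) ∞ Γ.verSection := by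
  intro a₀
  set x₀ : E := a₀.1 with hx₀
  set k := 𝓔.adaptedIndex x₀ with hk
  have hpr : ContMDiffAt (resModel n) (𝓡 (n + 1)) ∞ (TotalSpace.proj : 𝓔.RestrictedMomentum → E)
    a₀ := 𝓔.contMDiff_resProj.contMDiffAt
  refine contMDiffAt_covec_of_coord (b := (TotalSpace.proj : 𝓔.RestrictedMomentum → E))
    (A := fun a => Γ.verFiber a.1 a.2) hpr fun j => ?_
  have hver : ContMDiffAt (𝓡 (n + 1)) (𝓡 (n + 1)).tangent ∞
      (fun x => (⟨x, Γ.ver x (coordVec x₀ j x)⟩ : TangentBundle (𝓡 (n + 1)) E)) x₀ :=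
    (contMDiffAt_coordVec x₀ j).sub_section
      ((𝓔.contMDiffAt_clock_coordVec x₀ j).smul_section Γ.contMDiff_Y.contMDiffAt)
  -- The fibre coordinates are the second component of the identity map read in the bundle
  -- trivialization.
  have hp : ContMDiffAt (resModel n) 𝓘(ℝ, EuclideanSpace ℝ (Fin n)) ∞
      (fun a : 𝓔.RestrictedMomentum => 𝓔.fiberCoord x₀ k a.1 a.2) a₀ :=
    (contMDiffAt_totalSpace (F := EuclideanSpace ℝ (Fin n)) (E := 𝓔.RestrictedFiber)
      (f := id)).1 (contMDiff_id (I := resModel n)).contMDiffAt |>.2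
  have hs : ContMDiffAt (resModel n) 𝓘(ℝ, ℝ) ∞ (fun a : 𝓔.RestrictedMomentum =>
      ∑ i, 𝓔.fiberCoord x₀ k a.1 a.2 i *
        coordCovec x₀ (k.succAbove i) a.1 (Γ.ver a.1 (coordVec x₀ j a.1))) a₀ := by
    refine contMDiffAt_finsetSum fun i _ => ?_
    have h1 := (EuclideanSpace.proj i : EuclideanSpace ℝ (Fin n) →L[ℝ] ℝ).contMDiff (n := ∞)
      |>.contMDiffAt.comp a₀ hp
    exact h1.mul ((contMDiffAt_coordCovec_apply hver (k.succAbove i)).comp a₀ hpr)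
  refine hs.congr_of_eventuallyEq ?_
  filter_upwards [hpr.continuousAt.preimage_mem_nhds ((𝓔.isOpen_adaptedSet x₀ k).mem_nhds
    (𝓔.mem_adaptedSet_adaptedIndex x₀))] with a ha
  have h1 : Γ.verFiber a.1 a.2 (coordVec x₀ j a.1) = Γ.verFiber a.1
      (𝓔.fiberCoordSymm x₀ k a.1 (𝓔.fiberCoord x₀ k a.1 a.2)) (coordVec x₀ j a.1) := by
    rw [𝓔.fiberCoordSymm_coord ha]
  refine h1.trans ?_
  change (∑ i, 𝓔.fiberCoord x₀ k a.1 a.2 i • coordCovec x₀ (k.succAbove i) a.1)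
    (Γ.ver a.1 (coordVec x₀ j a.1)) = _
  simp

theorem contMDiff_hamSection {h : 𝓔.RestrictedMomentum → ℝ}
    (hh : ContMDiff (resModel n) 𝓘(ℝ, ℝ) ∞ h) :
    ContMDiff (resModel n) (extModel n) ∞ (Γ.hamSection h) := by
  intro a₀
  have hpr : ContMDiffAt (resModel n) (𝓡 (n + 1)) ∞ (TotalSpace.proj : 𝓔.RestrictedMomentum → E)
    a₀ := 𝓔.contMDiff_resProj.contMDiffAt
  refine contMDiffAt_covec_of_coord (b := (TotalSpace.proj : 𝓔.RestrictedMomentum → E))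
    (A := fun a => Γ.verFiber a.1 a.2 - h a • 𝓔.clock a.1) hpr fun j => ?_
  have h1 : ContMDiffAt (resModel n) 𝓘(ℝ, ℝ) ∞
      (fun a : 𝓔.RestrictedMomentum => Γ.verFiber a.1 a.2 (coordVec a₀.1 j a.1)) a₀ :=
    contMDiffAt_covec_apply (A := fun a : 𝓔.RestrictedMomentum => Γ.verFiber a.1 a.2)
      Γ.contMDiff_verSection.contMDiffAt ((contMDiffAt_coordVec a₀.1 j).comp a₀ hpr)
  exact h1.sub (hh.contMDiffAt.mul ((𝓔.contMDiffAt_clock_coordVec a₀.1 j).comp a₀ hpr))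

theorem verSection_mu (z : ExtendedMomentum n E) : Γ.verSection (𝓔.mu z) = Γ.verAdj z := rfl

theorem hamSection_mu (h : 𝓔.RestrictedMomentum → ℝ) (z : ExtendedMomentum n E) :
    Γ.hamSection h (𝓔.mu z) = Γ.hamMap h z := by
  refine congrArg (TotalSpace.mk z.1) (ContinuousLinearMap.ext
    fun v : TangentSpace (𝓡 (n + 1)) z.1 => ?_)
  change z.2 (v - 𝓔.clock z.1 v • Γ.Y z.1) - h (𝓔.mu z) * 𝓔.clock z.1 v =
    z.2 v - (h (𝓔.mu z) + z.2 (Γ.Y z.1)) * 𝓔.clock z.1 v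
  rw [map_sub, map_smul, smul_eq_mul]
  ring

/-- The covectors H(α) and α differ by a multiple of π^*ϖ, which vanishes on vertical vectors. -/
theorem mu_hamSection (h : 𝓔.RestrictedMomentum → ℝ) (a : 𝓔.RestrictedMomentum) :
    𝓔.mu (Γ.hamSection h a) = a := by
  obtain ⟨x, a⟩ := a
  obtain ⟨α, rfl⟩ := 𝓔.mkFiber_surjective x a
  refine congrArg (TotalSpace.mk x) (𝓔.mkFiber_eq_iff.2 fun
    (v : TangentSpace (𝓡 (n + 1)) x) hv => ?_)
  have hc := (𝓔.clock_eq_zero_iff v).2 hv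
  change α (v - 𝓔.clock x v • Γ.Y x) - h _ * 𝓔.clock x v - α v = 0
  simp [hc]

theorem hamSection_zero : Γ.hamSection 0 = Γ.verSection := by
  funext a
  refine congrArg (TotalSpace.mk a.1) ?_
  change Γ.verFiber a.1 a.2 - (0 : ℝ) • 𝓔.clock a.1 = _
  rw [zero_smul, sub_zero]

theorem mu_verSection (a : 𝓔.RestrictedMomentum) : 𝓔.mu (Γ.verSection a) = a := by
  rw [← hamSection_zero, mu_hamSection]

theorem diffFun_mu (z : ExtendedMomentum n E) :
    Γ.diffFun Γ' (𝓔.mu z) = momentumFun (fun x => Γ'.Y x - Γ.Y x) z := rfl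

/-- Since π^*ϖ(Y') = 1, one has Ver(Y') = Y' - Y. This presents the induced function as iY' along a
smooth section, which gives its smoothness. -/
theorem diffFun_eq (a : 𝓔.RestrictedMomentum) :
    Γ.diffFun Γ' a = momentumFun Γ'.Y (Γ.verSection a) := by
  obtain ⟨x, a⟩ := a
  obtain ⟨α, rfl⟩ := 𝓔.mkFiber_surjective x a
  change α (Γ'.Y x - Γ.Y x) = α (Γ'.Y x - 𝓔.clock x (Γ'.Y x) • Γ.Y x)
  rw [Γ'.clock_Y, one_smul]

/-- Ver(Y) = 0: the image of the section lies in the zero level set of iY. -/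
theorem momentumFun_verSection (a : 𝓔.RestrictedMomentum) :
    momentumFun Γ.Y (Γ.verSection a) = 0 := by
  obtain ⟨x, a⟩ := a
  obtain ⟨α, rfl⟩ := 𝓔.mkFiber_surjective x a
  change α (Γ.Y x - 𝓔.clock x (Γ.Y x) • Γ.Y x) = 0
  rw [Γ.clock_Y, one_smul, sub_self, map_zero]

theorem contMDiff_diffFun : ContMDiff (resModel n) 𝓘(ℝ, ℝ) ∞ (Γ.diffFun Γ') := by
  rw [show Γ.diffFun Γ' = momentumFun Γ'.Y ∘ Γ.verSection from funext (Γ.diffFun_eq Γ')]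
  exact (contMDiff_momentumFun Γ'.contMDiff_Y).comp Γ.contMDiff_verSection

/-- A change of connection is the addition of a Hamiltonian function. -/
theorem hamSection_diffFun : Γ.hamSection (Γ.diffFun Γ') = Γ'.verSection := by
  funext a
  obtain ⟨x, a⟩ := a
  obtain ⟨α, rfl⟩ := 𝓔.mkFiber_surjective x a
  refine congrArg (TotalSpace.mk x) ?_
  ext v
  change α (v - 𝓔.clock x v • Γ.Y x) - α (Γ'.Y x - Γ.Y x) * 𝓔.clock x v =
    α (v - 𝓔.clock x v • Γ'.Y x)
  simp only [map_sub, map_smul, smul_eq_mul]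
  ring

theorem omegaHam_zero : Γ.omegaHam 0 = Γ.omega := by
  rw [omegaHam, hamSection_zero, omega]

theorem omegaHam_diffFun : Γ.omegaHam (Γ.diffFun Γ') = Γ'.omega := by
  rw [omegaHam, hamSection_diffFun, omega]

end Connection
end FiberedManifold

/-- If the hyperplane `ker β` is the range of `S` and `S R` is dual to `β` for a nondegenerate
bilinear form, then the form pulled back along `S`, completed by a functional `e` with `e R = 1`,
is nondegenerate. -/
theorem injective_of_range_eq_ker {V W : Type*} [AddCommGroup V] [Module ℝ V] [AddCommGroup W]
    [Module ℝ W] {b : V →ₗ[ℝ] Module.Dual ℝ V} (hb : Injective b) {S : W →ₗ[ℝ] V}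
    (hS : Injective S) {β : Module.Dual ℝ V} (hβ : β ≠ 0) (hker : ∀ Z, β Z = 0 → ∃ u, S u = Z)
    {R : W} (hR : b (S R) = β) {e : Module.Dual ℝ W} (he : e R = 1)
    {L : W →ₗ[ℝ] Module.Dual ℝ W} (hL : ∀ u v, L u v = b (S u) (S v) + e u * e v)
    (hLR : ∀ v, b (S v) (S R) = 0) : Injective L := by
  refine (injective_iff_map_eq_zero _).2 fun v hv => ?_
  have hLv : ∀ u, b (S v) (S u) + e v * e u = 0 := fun u => by
    rw [← hL, hv, LinearMap.zero_apply]
  have hv0 : e v = 0 := by simpa [hLR, he] using hLv R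
  obtain ⟨Z, hZ⟩ : ∃ Z, β Z ≠ 0 := by
    by_contra! h
    exact hβ (LinearMap.ext h)
  -- The functional b(S v) vanishes on the range of S, which contains ker β, so it is a multiple of
  -- β = b(S R). Hence v = c R, and e(v) = 0 forces c = 0.
  obtain ⟨c, hc⟩ : ∃ c : ℝ, b (S v) = c • β := by
    refine ⟨b (S v) Z / β Z, LinearMap.ext fun T => ?_⟩
    obtain ⟨u, hu⟩ := hker (T - (β T / β Z) • Z) (by simp [hZ])
    have := hLv u
    rw [hu, hv0, map_sub, map_smul, smul_eq_mul, zero_mul, add_zero] at this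
    rw [LinearMap.smul_apply, smul_eq_mul, sub_eq_zero.1 this]
    ring
  rw [← hR, ← map_smul, ← map_smul] at hc
  have hvc : v = c • R := hS (hb hc)
  rw [hvc, map_smul, he, smul_eq_mul, mul_one] at hv0
  rw [hvc, hv0, zero_smul]

/-! ### Pulled-back forms and the Reeb vector of a connection -/

namespace FiberedManifold
variable {n : ℕ} {E B : Type*}
  [TopologicalSpace E] [ChartedSpace (EuclideanSpace ℝ (Fin (n + 1))) E]
  [IsManifold (𝓡 (n + 1)) ∞ E]
  [TopologicalSpace B] [ChartedSpace (EuclideanSpace ℝ (Fin 1)) B]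
  [IsManifold (𝓡 1) ∞ B] (𝓔 : FiberedManifold n E B)

/-- The derivative of the projection `J^{1*}E → E`. -/
noncomputable abbrev resProjDeriv (a : 𝓔.RestrictedMomentum) :
    TangentSpace (resModel n) a →L[ℝ] TangentSpace (𝓡 (n + 1)) a.1 :=
  mfderiv (resModel n) (𝓡 (n + 1)) (TotalSpace.proj : 𝓔.RestrictedMomentum → E) a

theorem eta_apply (a : 𝓔.RestrictedMomentum) (v : Fin 1 → TangentSpace (resModel n) a) :
    𝓔.eta a v = 𝓔.clock a.1 (𝓔.resProjDeriv a (v 0)) := by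
  have hn : (∞ : WithTop ℕ∞) ≠ 0 := by simp
  have hc := mfderiv_comp a (𝓔.contMDiff_proj.mdifferentiableAt hn)
    (𝓔.contMDiff_resProj.mdifferentiableAt hn)
  exact congrArg (fun T : TangentSpace (resModel n) a →L[ℝ] EuclideanSpace ℝ (Fin 1) =>
    𝓔.vol (𝓔.proj a.1) (T (v 0))) hc

theorem contMDiff_proj_comp : ContMDiff (resModel n) (𝓡 1) ∞
    fun a : 𝓔.RestrictedMomentum => 𝓔.proj a.1 :=
  𝓔.contMDiff_proj.comp 𝓔.contMDiff_resProj

theorem isSmooth_vol : (DForm.ofCLM (I := 𝓡 1) 𝓔.vol).IsSmooth :=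
  DForm.isSmooth_ofCLM 𝓔.contMDiff_vol

theorem isSmooth_eta : 𝓔.eta.IsSmooth := 𝓔.isSmooth_vol.pullback 𝓔.contMDiff_proj_comp

theorem d_eta : 𝓔.eta.d = 0 := by
  rw [eta, DForm.d_pullback 𝓔.isSmooth_vol 𝓔.contMDiff_proj_comp, d_eq_zero_of_one_dim]
  rfl

namespace Connection
variable {𝓔} (Γ Γ' : 𝓔.Connection)

section Hamiltonian

variable {h : 𝓔.RestrictedMomentum → ℝ}

theorem mfderiv_proj_hamSection (hh : ContMDiff (resModel n) 𝓘(ℝ, ℝ) ∞ h)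
    (a : 𝓔.RestrictedMomentum) (v : TangentSpace (resModel n) a) :
    mfderiv (extModel n) (𝓡 (n + 1)) (TotalSpace.proj : ExtendedMomentum n E → E)
      (Γ.hamSection h a) (mfderiv (resModel n) (extModel n) (Γ.hamSection h) a v) =
    𝓔.resProjDeriv a v := by
  have hn : (∞ : WithTop ℕ∞) ≠ 0 := by simp
  have hc := mfderiv_comp a (contMDiff_extProj.mdifferentiableAt hn)
    ((Γ.contMDiff_hamSection hh).mdifferentiableAt hn)
  exact (congrArg (fun T : TangentSpace (resModel n) a →L[ℝ] ModelVec n => T v) hc).symm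

/-- The tautological property of Θ: the section covers the identity of E, so σ_* of a pushed-forward
vector is its projection to E. -/
theorem pullback_liouville_apply (hh : ContMDiff (resModel n) 𝓘(ℝ, ℝ) ∞ h)
    (a : 𝓔.RestrictedMomentum)
    (v : Fin 1 → TangentSpace (resModel n) a) :
    DForm.pullback (resModel n) (Γ.hamSection h) (liouville n E) a v =
      (Γ.hamSection h a).2 (𝓔.resProjDeriv a (v 0)) :=
  congrArg (Γ.hamSection h a).2 (Γ.mfderiv_proj_hamSection hh a (v 0))

theorem isSmooth_omegaHam (hh : ContMDiff (resModel n) 𝓘(ℝ, ℝ) ∞ h) : (Γ.omegaHam h).IsSmooth :=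
  isSmooth_canonicalForm.pullback (Γ.contMDiff_hamSection hh)

theorem d_omegaHam (hh : ContMDiff (resModel n) 𝓘(ℝ, ℝ) ∞ h) : (Γ.omegaHam h).d = 0 := by
  rw [omegaHam, DForm.d_pullback isSmooth_canonicalForm (Γ.contMDiff_hamSection hh),
    d_canonicalForm]
  rfl

theorem omegaHam_eq_neg_d (hh : ContMDiff (resModel n) 𝓘(ℝ, ℝ) ∞ h) : Γ.omegaHam h =
    -(DForm.pullback (resModel n) (Γ.hamSection h) (liouville n E)).d := by
  rw [DForm.d_pullback isSmooth_liouville (Γ.contMDiff_hamSection hh)]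
  rfl

theorem pullback_liouville_hamSection (hh : ContMDiff (resModel n) 𝓘(ℝ, ℝ) ∞ h) :
    DForm.pullback (resModel n) (Γ.hamSection h) (liouville n E) =
      DForm.pullback (resModel n) Γ.verSection (liouville n E) +
        -(fun a => h a • 𝓔.eta a : DForm (resModel n) 𝓔.RestrictedMomentum 1) := by
  funext a
  ext v
  have h0 := Γ.pullback_liouville_apply (h := 0) contMDiff_const a v
  rw [hamSection_zero] at h0
  have h1 := Γ.pullback_liouville_apply hh a v
  have h2 := 𝓔.eta_apply a v
  refine h1.trans ?_
  change Γ.verFiber a.1 a.2 (𝓔.resProjDeriv a (v 0)) - h a * 𝓔.clock a.1 (𝓔.resProjDeriv a (v 0)) =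
    DForm.pullback (resModel n) Γ.verSection (liouville n E) a v + -(h a * 𝓔.eta a v)
  rw [h0, h2]
  rfl

/-- The pullbacks of Θ differ by -h η̃, and -d of this is dh ∧ η̃ + h dη̃, where dη̃ = 0. -/
theorem omegaHam_eq (hh : ContMDiff (resModel n) 𝓘(ℝ, ℝ) ∞ h) : Γ.omegaHam h =
    Γ.omega + (DForm.diff (resModel n) h).wedge 𝓔.eta := by
  have hs : (DForm.pullback (resModel n) Γ.verSection (liouville n E)).IsSmooth :=
    isSmooth_liouville.pullback Γ.contMDiff_verSection
  have h0 := Γ.omegaHam_eq_neg_d (h := 0) contMDiff_const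
  rw [omegaHam_zero, hamSection_zero] at h0
  have hz : (fun a => h a • 𝓔.eta.d a : DForm (resModel n) 𝓔.RestrictedMomentum 2) = 0 := by
    funext a
    rw [d_eta]
    exact smul_zero _
  rw [Γ.omegaHam_eq_neg_d hh, pullback_liouville_hamSection Γ hh,
    DForm.d_add hs (𝓔.isSmooth_eta.smul hh).neg, DForm.d_neg, DForm.d_smul hh 𝓔.isSmooth_eta, hz,
    add_zero, h0, neg_add, neg_neg]

end Hamiltonian

/-- The derivative of μ is a left inverse, because μ ∘ s = id. -/
theorem injective_mfderiv_verSection (a : 𝓔.RestrictedMomentum) :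
    Injective (mfderiv (resModel n) (extModel n) Γ.verSection a) := by
  have hn : (∞ : WithTop ℕ∞) ≠ 0 := by simp
  have hc := mfderiv_comp a (𝓔.contMDiff_mu.mdifferentiableAt hn)
    (Γ.contMDiff_verSection.mdifferentiableAt hn)
  rw [show 𝓔.mu ∘ Γ.verSection = id from funext Γ.mu_verSection, mfderiv_id] at hc
  intro u v huv
  have h1 := congrArg (mfderiv (extModel n) (resModel n) 𝓔.mu (Γ.verSection a)) huv
  exact (congrArg (fun T : (EuclideanSpace ℝ (Fin (n + 1)) × EuclideanSpace ℝ (Fin n)) →L[ℝ]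
    (EuclideanSpace ℝ (Fin (n + 1)) × EuclideanSpace ℝ (Fin n)) => T u) hc).trans (h1.trans
    (congrArg (fun T : (EuclideanSpace ℝ (Fin (n + 1)) × EuclideanSpace ℝ (Fin n)) →L[ℝ]
    (EuclideanSpace ℝ (Fin (n + 1)) × EuclideanSpace ℝ (Fin n)) => T v) hc).symm)

theorem diff_momentumFun_mfderiv_verSection (a : 𝓔.RestrictedMomentum)
    (v : TangentSpace (resModel n) a) :
    (DForm.diff (extModel n) (momentumFun Γ.Y)).covec (Γ.verSection a)
      (mfderiv (resModel n) (extModel n) Γ.verSection a v) = 0 := by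
  have hn : (∞ : WithTop ℕ∞) ≠ 0 := by simp
  have hc := mfderiv_comp a ((contMDiff_momentumFun Γ.contMDiff_Y).mdifferentiableAt hn)
    (Γ.contMDiff_verSection.mdifferentiableAt hn)
  rw [show momentumFun Γ.Y ∘ Γ.verSection = fun _ => 0 from funext Γ.momentumFun_verSection,
    mfderiv_const] at hc
  exact (congrArg (fun T : TangentSpace (resModel n) a →L[ℝ] ℝ => T v) hc).symm

theorem finrank_ext (z : ExtendedMomentum n E) :
    Module.finrank ℝ (TangentSpace (extModel n) z) = 2 * n + 2 := by
  change Module.finrank ℝ (ModelVec n × (ModelVec n →L[ℝ] ℝ)) = _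
  rw [Module.finrank_prod, ← (LinearMap.toContinuousLinearMap (𝕜 := ℝ) (E := ModelVec n)
    (F' := ℝ)).finrank_eq, Subspace.dual_finrank_eq (K := ℝ) (V := ModelVec n)]
  simp
  ring

theorem finrank_res (a : 𝓔.RestrictedMomentum) :
    Module.finrank ℝ (TangentSpace (resModel n) a) = 2 * n + 1 := by
  change Module.finrank ℝ (ModelVec n × EuclideanSpace ℝ (Fin n)) = _
  rw [Module.finrank_prod]
  simp
  ring

/-- The image of the section is tangent to the zero level set of `iY`. -/
theorem exists_mfderiv_verSection_eq {a : 𝓔.RestrictedMomentum}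
    {X : TangentSpace (extModel n) (Γ.verSection a)}
    (hne : (DForm.diff (extModel n) (momentumFun Γ.Y)).covec (Γ.verSection a) ≠ 0)
    (hX : (DForm.diff (extModel n) (momentumFun Γ.Y)).covec (Γ.verSection a) X = 0) :
    ∃ R, mfderiv (resModel n) (extModel n) Γ.verSection a R = X := by
  set β := (DForm.diff (extModel n) (momentumFun Γ.Y)).covec (Γ.verSection a) with hβ
  have : FiniteDimensional ℝ (TangentSpace (extModel n) (Γ.verSection a)) :=
    inferInstanceAs (FiniteDimensional ℝ (ModelVec n × (ModelVec n →L[ℝ] ℝ)))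
  set S : TangentSpace (resModel n) a →ₗ[ℝ] TangentSpace (extModel n) (Γ.verSection a) :=
    (mfderiv (resModel n) (extModel n) Γ.verSection a).toLinearMap with hS
  have h1 : LinearMap.range S ≤ LinearMap.ker β := by
    rintro _ ⟨v, rfl⟩
    exact Γ.diff_momentumFun_mfderiv_verSection a v
  have h2 : Module.finrank ℝ (LinearMap.range S) = 2 * n + 1 :=
    (LinearMap.finrank_range_of_inj (Γ.injective_mfderiv_verSection a)).trans (finrank_res a)
  have h3 : Module.finrank ℝ (LinearMap.ker β) + 1 = 2 * n + 2 := by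
    rw [← finrank_ext (Γ.verSection a)]
    exact Module.Dual.finrank_ker_add_one_of_ne_zero hne
  -- Both have dimension 2n + 1: s is an immersion of J^{1*}E, and β ≠ 0 on a space of dimension 2n
  -- + 2.
  have h4 : LinearMap.range S = LinearMap.ker β :=
    Submodule.eq_of_le_of_finrank_eq h1 (by omega)
  have h5 : X ∈ LinearMap.range S := h4 ▸ hX
  exact h5

/-- If d(iY) vanished at z, then so would X by nondegeneracy, although X projects to Y and π^*ϖ(Y) =
1. -/
theorem diff_momentumFun_ne_zero {z : ExtendedMomentum n E} {X : TangentSpace (extModel n) z}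
    (hX : (canonicalForm n E).interior z X =
      (DForm.diff (extModel n) (momentumFun Γ.Y)).covec z) :
    (DForm.diff (extModel n) (momentumFun Γ.Y)).covec z ≠ 0 := fun h0 => by
  have hpX := mfderiv_proj_of_interior_eq Γ.contMDiff_Y hX
  have hX0 := (injective_iff_map_eq_zero _).1 (injective_interior_canonicalForm _) X (hX.trans h0)
  rw [hX0] at hpX
  have h1 : Γ.Y z.1 = 0 := hpX.symm.trans (ContinuousLinearMap.map_zero _)
  have h2 := Γ.clock_Y z.1
  rw [h1, map_zero] at h2
  exact zero_ne_one h2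

theorem omega_interior (a : 𝓔.RestrictedMomentum) (u v : TangentSpace (resModel n) a) :
    Γ.omega.interior a u v = (canonicalForm n E).interior (Γ.verSection a)
      (mfderiv (resModel n) (extModel n) Γ.verSection a u)
      (mfderiv (resModel n) (extModel n) Γ.verSection a v) := by
  rw [DForm.interior_apply, DForm.interior_apply, omega, DForm.pullback_apply]
  refine congrArg (canonicalForm n E (Γ.verSection a)) ?_
  ext i
  fin_cases i <;> rfl

/-- The Reeb vector of the cosymplectic structure of a connection is mapped to the Hamiltonian
vector of `iY`. -/
theorem exists_isReebVector (a : 𝓔.RestrictedMomentum) :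
    ∃ R, IsReebVector Γ.omega 𝓔.eta a R ∧
      mfderiv (resModel n) (extModel n) Γ.verSection a R =
        sympHamField (canonicalForm n E) (momentumFun Γ.Y) (Γ.verSection a) := by
  have hX : (canonicalForm n E).interior (Γ.verSection a)
      (sympHamField (canonicalForm n E) (momentumFun Γ.Y) (Γ.verSection a)) =
      (DForm.diff (extModel n) (momentumFun Γ.Y)).covec (Γ.verSection a) :=
    rightInverse_invFun (bijective_interior_canonicalForm _).2 _
  have hpX := mfderiv_proj_of_interior_eq Γ.contMDiff_Y hX
  generalize sympHamField (canonicalForm n E) (momentumFun Γ.Y) (Γ.verSection a) = X at hX hpX ⊢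
  have hβ0 := Γ.diff_momentumFun_ne_zero hX
  -- Here d(iY)(X) = Ω(X, X) = 0, so X is tangent to the image of the section.
  obtain ⟨R, rfl⟩ := Γ.exists_mfderiv_verSection_eq hβ0
    (by rw [← hX]; exact DForm.interior_self _ _ _)
  have hRint : Γ.omega.interior a R = 0 := by
    ext v
    rw [omega_interior, hX]
    exact Γ.diff_momentumFun_mfderiv_verSection a v
  -- The projection of R to E is that of X, namely Y, and π^*ϖ(Y) = 1.
  have hReta : 𝓔.eta.covec a R = 1 := by
    rw [DForm.covec_apply, eta_apply]
    have h0 := Γ.mfderiv_proj_hamSection (h := 0) contMDiff_const a R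
    rw [hamSection_zero, hpX] at h0
    change 𝓔.clock a.1 (𝓔.resProjDeriv a R) = 1
    rw [← h0]
    exact Γ.clock_Y a.1
  refine ⟨R, ⟨?_, hRint, hReta⟩, rfl⟩
  refine injective_of_range_eq_ker (injective_interior_canonicalForm (Γ.verSection a))
    (S := (mfderiv (resModel n) (extModel n) Γ.verSection a).toLinearMap)
    (Γ.injective_mfderiv_verSection a) hβ0 (fun Z hZ => Γ.exists_mfderiv_verSection_eq hβ0 hZ)
    hX hReta (fun u v => ?_) fun v => ?_
  · rw [flat_apply, LinearMap.add_apply, omega_interior]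
    rfl
  · refine (Γ.omega_interior a v R).symm.trans ?_
    rw [DForm.interior_swap, hRint, LinearMap.zero_apply, neg_zero]

end Connection
end FiberedManifold

/-! ### The cosymplectic structures and their fields -/

namespace FiberedManifold.Connection
variable {n : ℕ} {E B : Type*}
  [TopologicalSpace E] [ChartedSpace (EuclideanSpace ℝ (Fin (n + 1))) E]
  [IsManifold (𝓡 (n + 1)) ∞ E]
  [TopologicalSpace B] [ChartedSpace (EuclideanSpace ℝ (Fin 1)) B]
  [IsManifold (𝓡 1) ∞ B] {𝓔 : FiberedManifold n E B} (Γ Γ' : 𝓔.Connection)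

theorem isReebVector_reebField (a : 𝓔.RestrictedMomentum) :
    IsReebVector Γ.omega 𝓔.eta a (reebField Γ.omega 𝓔.eta a) := by
  obtain ⟨R, hR, -⟩ := Γ.exists_isReebVector a
  rwa [hR.reebField_eq]

theorem mfderiv_verSection_reebField (a : 𝓔.RestrictedMomentum) :
    mfderiv (resModel n) (extModel n) Γ.verSection a (reebField Γ.omega 𝓔.eta a) =
      sympHamField (canonicalForm n E) (momentumFun Γ.Y) (Γ.verSection a) := by
  obtain ⟨R, hR, h⟩ := Γ.exists_isReebVector a
  rwa [hR.reebField_eq]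

theorem isReebVector_omegaHam {h : 𝓔.RestrictedMomentum → ℝ}
    (hh : ContMDiff (resModel n) 𝓘(ℝ, ℝ) ∞ h) (a : 𝓔.RestrictedMomentum) :
    IsReebVector (Γ.omegaHam h) 𝓔.eta a
      (reebField Γ.omega 𝓔.eta a + cosympHamField Γ.omega 𝓔.eta h a) := by
  rw [Γ.omegaHam_eq hh]
  exact (Γ.isReebVector_reebField a).add_wedge h

theorem isCosymplectic_omegaHam {h : 𝓔.RestrictedMomentum → ℝ}
    (hh : ContMDiff (resModel n) 𝓘(ℝ, ℝ) ∞ h) : IsCosymplectic (Γ.omegaHam h) 𝓔.eta where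
  odd_dim := by
    rw [Module.finrank_prod, finrank_euclideanSpace_fin, finrank_euclideanSpace_fin]
    exact ⟨n, by ring⟩
  smooth_two := Γ.isSmooth_omegaHam hh
  smooth_one := 𝓔.isSmooth_eta
  closed_two := Γ.d_omegaHam hh
  closed_one := 𝓔.d_eta
  bijective_flat a := (Γ.isReebVector_omegaHam hh a).bijective_flat

/-- The case h = 0 of the Hamiltonian construction. -/
theorem isCosymplectic_omega : IsCosymplectic Γ.omega 𝓔.eta := by
  rw [← Γ.omegaHam_zero]
  exact Γ.isCosymplectic_omegaHam contMDiff_const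

theorem omega_eq_add_wedge : Γ'.omega =
    Γ.omega + (DForm.diff (resModel n) (Γ.diffFun Γ')).wedge 𝓔.eta := by
  rw [← Γ.omegaHam_diffFun Γ', Γ.omegaHam_eq (Γ.contMDiff_diffFun Γ')]

theorem cosympHamField_omegaHam {h : 𝓔.RestrictedMomentum → ℝ}
    (hh : ContMDiff (resModel n) 𝓘(ℝ, ℝ) ∞ h) (f : 𝓔.RestrictedMomentum → ℝ) :
    cosympHamField (Γ.omegaHam h) 𝓔.eta f = cosympHamField Γ.omega 𝓔.eta f := by
  funext a
  rw [Γ.omegaHam_eq hh, (Γ.isReebVector_reebField a).cosympHamField_add_wedge]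

theorem cosympBracket_omegaHam {h : 𝓔.RestrictedMomentum → ℝ}
    (hh : ContMDiff (resModel n) 𝓘(ℝ, ℝ) ∞ h) (f g : 𝓔.RestrictedMomentum → ℝ) :
    cosympBracket (Γ.omegaHam h) 𝓔.eta f g = cosympBracket Γ.omega 𝓔.eta f g := by
  funext a
  rw [Γ.omegaHam_eq hh, (Γ.isReebVector_reebField a).cosympBracket_add_wedge]

theorem reebField_omegaHam {h : 𝓔.RestrictedMomentum → ℝ}
    (hh : ContMDiff (resModel n) 𝓘(ℝ, ℝ) ∞ h) :
    reebField (Γ.omegaHam h) 𝓔.eta =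
      reebField Γ.omega 𝓔.eta + cosympHamField Γ.omega 𝓔.eta h :=
  funext fun a => (Γ.isReebVector_omegaHam hh a).reebField_eq

theorem evolutionField_omega (h : 𝓔.RestrictedMomentum → ℝ) :
    evolutionField Γ.omega 𝓔.eta h =
      reebField Γ.omega 𝓔.eta + cosympHamField Γ.omega 𝓔.eta h :=
  funext fun a => (Γ.isReebVector_reebField a).evolutionField_eq h

end FiberedManifold.Connection

theorem mainTheorem9 {n : ℕ} {E B : Type*}
    [TopologicalSpace E] [ChartedSpace (EuclideanSpace ℝ (Fin (n + 1))) E]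
    [IsManifold (𝓡 (n + 1)) ∞ E]
    [TopologicalSpace B] [ChartedSpace (EuclideanSpace ℝ (Fin 1)) B]
    [IsManifold (𝓡 1) ∞ B]
    (𝓔 : FiberedManifold n E B) :
    -- the cosymplectic structure defined by a connection and its Reeb field
    (∀ Γ : 𝓔.Connection,
      ContMDiff (resModel n) (extModel n) ∞ Γ.verSection ∧
      (∀ z, Γ.verSection (𝓔.mu z) = Γ.verAdj z) ∧
      (∀ a, 𝓔.mu (Γ.verSection a) = a) ∧
      IsCosymplectic Γ.omega 𝓔.eta ∧
      ∀ a, mfderiv (resModel n) (extModel n) Γ.verSection a (reebField Γ.omega 𝓔.eta a) =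
        sympHamField (canonicalForm n E) (momentumFun Γ.Y) (Γ.verSection a)) ∧
    -- change of the connection
    (∀ Γ Γ' : 𝓔.Connection,
      ContMDiff (resModel n) 𝓘(ℝ, ℝ) ∞ (Γ.diffFun Γ') ∧
      (∀ z, Γ.diffFun Γ' (𝓔.mu z) = momentumFun (fun x => Γ'.Y x - Γ.Y x) z) ∧
      Γ'.omega = Γ.omega + (DForm.diff (resModel n) (Γ.diffFun Γ')).wedge 𝓔.eta ∧
      (∀ f : 𝓔.RestrictedMomentum → ℝ, ContMDiff (resModel n) 𝓘(ℝ, ℝ) ∞ f →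
        cosympHamField Γ.omega 𝓔.eta f = cosympHamField Γ'.omega 𝓔.eta f) ∧
      ∀ f g : 𝓔.RestrictedMomentum → ℝ, ContMDiff (resModel n) 𝓘(ℝ, ℝ) ∞ f →
        ContMDiff (resModel n) 𝓘(ℝ, ℝ) ∞ g →
        cosympBracket Γ'.omega 𝓔.eta f g = cosympBracket Γ.omega 𝓔.eta f g) ∧
    -- the cosymplectic structure defined by a connection and a Hamiltonian function
    (∀ (Γ : 𝓔.Connection) (h : 𝓔.RestrictedMomentum → ℝ),
      ContMDiff (resModel n) 𝓘(ℝ, ℝ) ∞ h →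
      ContMDiff (resModel n) (extModel n) ∞ (Γ.hamSection h) ∧
      (∀ z, Γ.hamSection h (𝓔.mu z) = Γ.hamMap h z) ∧
      (∀ a, 𝓔.mu (Γ.hamSection h a) = a) ∧
      Γ.omegaHam h = Γ.omega + (DForm.diff (resModel n) h).wedge 𝓔.eta ∧
      IsCosymplectic (Γ.omegaHam h) 𝓔.eta ∧
      reebField (Γ.omegaHam h) 𝓔.eta =
        reebField Γ.omega 𝓔.eta + cosympHamField Γ.omega 𝓔.eta h ∧
      reebField (Γ.omegaHam h) 𝓔.eta = evolutionField Γ.omega 𝓔.eta h ∧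
      (∀ f : 𝓔.RestrictedMomentum → ℝ, ContMDiff (resModel n) 𝓘(ℝ, ℝ) ∞ f →
        cosympHamField (Γ.omegaHam h) 𝓔.eta f = cosympHamField Γ.omega 𝓔.eta f) ∧
      ∀ f g : 𝓔.RestrictedMomentum → ℝ, ContMDiff (resModel n) 𝓘(ℝ, ℝ) ∞ f →
        ContMDiff (resModel n) 𝓘(ℝ, ℝ) ∞ g →
        cosympBracket Γ.omega 𝓔.eta f g = cosympBracket (Γ.omegaHam h) 𝓔.eta f g) := by
  refine ⟨fun Γ => ⟨Γ.contMDiff_verSection, Γ.verSection_mu, Γ.mu_verSection,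
      Γ.isCosymplectic_omega, Γ.mfderiv_verSection_reebField⟩,
    fun Γ Γ' => ⟨Γ.contMDiff_diffFun Γ', Γ.diffFun_mu Γ', Γ.omega_eq_add_wedge Γ',
      fun f _ => ?_, fun f g _ _ => ?_⟩,
    fun Γ h hh => ⟨Γ.contMDiff_hamSection hh, Γ.hamSection_mu h, Γ.mu_hamSection h,
      Γ.omegaHam_eq hh, Γ.isCosymplectic_omegaHam hh, Γ.reebField_omegaHam hh,
      (Γ.reebField_omegaHam hh).trans (Γ.evolutionField_omega h).symm,
      fun f _ => Γ.cosympHamField_omegaHam hh f,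
      fun f g _ _ => (Γ.cosympBracket_omegaHam hh f g).symm⟩⟩
  -- The second connection is the first with Hamiltonian `diffFun`, so invariance under adding a
  -- Hamiltonian applies.
  · rw [← Γ.omegaHam_diffFun Γ', Γ.cosympHamField_omegaHam (Γ.contMDiff_diffFun Γ')]
  · rw [← Γ.omegaHam_diffFun Γ', Γ.cosympBracket_omegaHam (Γ.contMDiff_diffFun Γ')]
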